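/- Let $A\in\mathbb{R}^{n\times n}$, $B\in\mathbb{R}^{n\times m}$ with $(A,B)$ controllable, and let $T>0$, $N\in\mathbb{N}$ be such that $T\neq 2\pi k/|\mathrm{Im}(\lambda_i-\lambda_j)|$ for all $k\in\mathbb{Z}$ and all eigenvalues $\lambda_i,\lambda_j$ of $A$ with distinct imaginary parts. Let $u:[0,NT]\to\mathbb{R}^m$ be a piecewise constant persistently exciting input of order $n+1$, i.e. $u(s+iT)=\mu_i$ for $0\le s<T$, $i=0,\dots,N-1$, where the block Hankel matrix of $\mu_0,\dots,\mu_{N-1}$ with $n+1$ block rows has rank $m(n+1)$, and let $x:[0,NT]\to\mathbb{R}^n$ be a corresponding state trajectory of $\dot x=Ax+Bu$. Fix $t\in[0,T]$ and put $H_u=[\mu_0\ \cdots\ \mu_{N-1}]$, $H_x=[x(t)\ x(t+T)\ \cdots\ x(t+(N-1)T)]$, $H_{\dot x}=[\dot x(t)\ \dot x(t+T)\ \cdots\ \dot x(t+(N-1)T)]$ and $H_A=AH_x$, where $\dot x(t+iT)$ is taken on the block $[iT,(i+1)T]$ (one-sided at its end points). Let $K\in\mathbb{R}^{m\times n}$ be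 stabilizing (all eigenvalues of $A-BK$ have negative real part). Let $\xi^i,\nu^i$, $i=1,\dots,M$, satisfy $\dot\xi^i=(A-BK)\xi^i$ and $\nu^i=-K\xi^i$ on $[0,T]$, let $t_0,\dots,t_{q-1}\in[0,T]$, and let $\hat\Xi,\dot{\hat\Xi}\in\mathbb{R}^{n\times qM}$, $\hat{\mathcal U}\in\mathbb{R}^{m\times qM}$ be the matrices whose columns are all the samples $\xi^i(t_j)$, $\dot\xi^i(t_j)$, $\nu^i(t_j)$, respectively, in the same order. Assume that $\hat\Xi$ has full row rank. Consider the data-based program of minimizing $$\|H_u^\top R\,\hat{\mathcal U}+H_{\dot x}^\top P\hat\Xi-H_A^\top P\hat\Xi\|_F$$ over $(Q,R,P,P_1)$ subject to $Q,P\succeq0$, $R,P_1\succ0$, $$\hat\Xi^\top Q\hat\Xi+\hat{\mathcal U}^\top R\,\hat{\mathcal U}+\hat\Xi^\top P\dot{\hat\Xi}+\dot{\hat\Xi}^\top P\hat\Xi=0,$$ $$v^\top\big(H_x^\top QH_x-H_x^\top P_1H_A-H_A^\top P_1H_x\big)v>0\quad\text{for all }v\in\mathbb{R}^N\text{ with }H_xv\neq0.$$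 This program is convex and feasible. Its feasible points are exactly the $(Q,R,P,P_1)$ with $Q,P\succeq0$, $R,P_1\succ0$, $Q+K^\top RK+P(A-BK)+(A-BK)^\top P=0$ and $Q-P_1A-A^\top P_1\succ0$, and its solutions (minimizers) are exactly the points that minimize $\|RK-B^\top P\|_F$ under these last constraints. Moreover, if for some $Q\succeq0$, $R\succ0$ the feedback $u=-Kx$ minimizes $\int_0^\infty (x^\top Qx+u^\top Ru)\,dt$ for every initial state, then the program has a solution, and its optimal value is zero. -/

import Mathlib

open Set Matrix MeasureTheory
open scoped ENNReal

namespace InverseLQR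

noncomputable section

/-! ### Linear time-invariant systems -/

/-- `(A, B)` is controllable: the matrix `[B, AB, ..., A^(n-1) B]` has rank `n`. -/
def Controllable {n m : ℕ} (A : Matrix (Fin n) (Fin n) ℝ) (B : Matrix (Fin n) (Fin m) ℝ) : Prop :=
  (Matrix.of fun (r : Fin n) (p : Fin n × Fin m) => (A ^ (p.1 : ℕ) * B) r p.2).rank = n

/-- The complex number `z` is an eigenvalue of the real matrix `A`. -/
def IsEigenvalue {n : ℕ} (A : Matrix (Fin n) (Fin n) ℝ) (z : ℂ) : Prop :=
  Module.End.HasEigenvalue (Matrix.toLin' (A.map (algebraMap ℝ ℂ))) z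

/-- The gain `K` is stabilizing: all eigenvalues of `A - B K` have negative real part. -/
def Stabilizing {n m : ℕ} (A : Matrix (Fin n) (Fin n) ℝ) (B : Matrix (Fin n) (Fin m) ℝ)
    (K : Matrix (Fin m) (Fin n) ℝ) : Prop :=
  ∀ z : ℂ, IsEigenvalue (A - B * K) z → z.re < 0

/-- `x` is the state of `ẋ = A x + B u` on `[0, τ]` under the input `u` (which may be
discontinuous): `x` is continuous and satisfies the integrated equation. -/
def IsTrajectory {n m : ℕ} (A : Matrix (Fin n) (Fin n) ℝ) (B : Matrix (Fin n) (Fin m) ℝ)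
    (u : ℝ → Fin m → ℝ) (x : ℝ → Fin n → ℝ) (τ : ℝ) : Prop :=
  ContinuousOn x (Icc 0 τ) ∧ IntervalIntegrable u volume 0 τ ∧
    ∀ t ∈ Icc 0 τ, x t = x 0 + ∫ s in (0 : ℝ)..t, (A *ᵥ x s + B *ᵥ u s)

/-! ### Persistently exciting data -/

/-- `T` avoids the values `2 π k / |Im (z - w)|`, `k ∈ ℤ`, for all pairs `z, w` of eigenvalues of
`A` with distinct imaginary parts. -/
def NonpathologicalPeriod {n : ℕ} (A : Matrix (Fin n) (Fin n) ℝ) (T : ℝ) : Prop :=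
  ∀ z w : ℂ, IsEigenvalue A z → IsEigenvalue A w → (z - w).im ≠ 0 →
    ∀ k : ℤ, T ≠ 2 * Real.pi * k / |(z - w).im|

/-- The block Hankel matrix with `L` block rows of the finite sequence `μ 0, ..., μ (N - 1)`;
it has `N - L + 1` columns (and none if `N < L`). -/
def blockHankel {m : ℕ} (μ : ℕ → Fin m → ℝ) (N L : ℕ) :
    Matrix (Fin L × Fin m) (Fin (N + 1 - L)) ℝ :=
  Matrix.of fun p j => μ (p.1 + j) p.2

/-- `u` is a piecewise constant persistently exciting input of order `L` on `[0, N T]` for a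
system with state matrix `A`. -/
def IsPCPE {n m : ℕ} (A : Matrix (Fin n) (Fin n) ℝ) (T : ℝ) (N L : ℕ) (u : ℝ → Fin m → ℝ) : Prop :=
  NonpathologicalPeriod A T ∧
    ∃ μ : ℕ → Fin m → ℝ, (∀ i < N, ∀ t ∈ Ico 0 T, u (t + i * T) = μ i) ∧
      (blockHankel μ N L).rank = m * L

/-- The matrix `[f t, f (t + T), ..., f (t + (N - 1) T)]`. -/
def hankelRow {d : ℕ} (T : ℝ) (N : ℕ) (f : ℝ → Fin d → ℝ) (t : ℝ) : Matrix (Fin d) (Fin N) ℝ :=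
  Matrix.of fun r i => f (t + i * T) r

/-- The matrix `[ẋ t, ẋ (t + T), ..., ẋ (t + (N - 1) T)]` for `t ∈ [0, T]`. The input may jump at
the multiples of `T`, so column `i` is the derivative of `x` on the block `[i T, (i + 1) T]`
(one-sided at its two end points). -/
def hankelRowDeriv {d : ℕ} (T : ℝ) (N : ℕ) (x : ℝ → Fin d → ℝ) (t : ℝ) :
    Matrix (Fin d) (Fin N) ℝ :=
  Matrix.of fun r i => derivWithin x (Icc ((i : ℝ) * T) (((i : ℝ) + 1) * T)) (t + i * T) r

/-! ### Closed-loop samples -/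

/-- `ξ`, `ν`, `ξd` are a state trajectory, its input and its derivative on `[0, T]` for the system
`ẋ = A x + B u` in closed loop with `u = -K x`. -/
def IsClosedLoopData {n m : ℕ} (A : Matrix (Fin n) (Fin n) ℝ) (B : Matrix (Fin n) (Fin m) ℝ)
    (K : Matrix (Fin m) (Fin n) ℝ) (T : ℝ) (ξ : ℝ → Fin n → ℝ) (ν : ℝ → Fin m → ℝ)
    (ξd : ℝ → Fin n → ℝ) : Prop :=
  ∀ t ∈ Icc 0 T, HasDerivWithinAt ξ (ξd t) (Icc 0 T) t ∧
    ξd t = (A - B * K) *ᵥ ξ t ∧ ν t = -(K *ᵥ ξ t)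

/-- The horizontal concatenation, over the sampling times `τ j`, of the matrices
`[f 1 (τ j), ..., f M (τ j)]`. -/
def sampleMatrix {d q M : ℕ} (f : Fin M → ℝ → Fin d → ℝ) (τ : Fin q → ℝ) :
    Matrix (Fin d) (Fin q × Fin M) ℝ :=
  Matrix.of fun r p => f p.2 (τ p.1) r

/-- The matrices entering the data-based program. -/
structure ProgramData (n m N q M : ℕ) where
  /-- input data -/
  Hu : Matrix (Fin m) (Fin N) ℝ
  /-- state data -/
  Hx : Matrix (Fin n) (Fin N) ℝ
  /-- state derivative data -/
  Hxd : Matrix (Fin n) (Fin N) ℝ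
  /-- state data multiplied by the state matrix -/
  HA : Matrix (Fin n) (Fin N) ℝ
  /-- closed-loop state samples -/
  Xi : Matrix (Fin n) (Fin q × Fin M) ℝ
  /-- closed-loop state derivative samples -/
  Xid : Matrix (Fin n) (Fin q × Fin M) ℝ
  /-- closed-loop input samples -/
  U : Matrix (Fin m) (Fin q × Fin M) ℝ

/-- The program data at the time `t`. The input is constant on each block `[i T, (i + 1) T)`, so
its data matrix does not depend on `t` and is evaluated at `0`. -/
def collect {n m q M : ℕ} (A : Matrix (Fin n) (Fin n) ℝ) (T : ℝ) (N : ℕ)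
    (u : ℝ → Fin m → ℝ) (x : ℝ → Fin n → ℝ) (t : ℝ)
    (ξ : Fin M → ℝ → Fin n → ℝ) (ν : Fin M → ℝ → Fin m → ℝ) (ξd : Fin M → ℝ → Fin n → ℝ)
    (τ : Fin q → ℝ) : ProgramData n m N q M where
  Hu := hankelRow T N u 0
  Hx := hankelRow T N x t
  Hxd := hankelRowDeriv T N x t
  HA := A * hankelRow T N x t
  Xi := sampleMatrix ξ τ
  Xid := sampleMatrix ξd τ
  U := sampleMatrix ν τ

/-! ### The two optimization problems -/

section Frobenius

attribute [local instance] Matrix.frobeniusNormedAddCommGroup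

/-- The Frobenius norm. -/
def frobNorm {ι κ : Type*} [Fintype ι] [Fintype κ] (M : Matrix ι κ ℝ) : ℝ := ‖M‖

end Frobenius

/-- The decision variables `(Q, R, P, P₁)`. -/
abbrev Vars (n m : ℕ) : Type :=
  Matrix (Fin n) (Fin n) ℝ × Matrix (Fin m) (Fin m) ℝ ×
    Matrix (Fin n) (Fin n) ℝ × Matrix (Fin n) (Fin n) ℝ

/-- `z` is a solution of the problem of minimizing `f` over the feasible set `S`. -/
def IsSolution {E : Type*} (S : Set E) (f : E → ℝ) (z : E) : Prop :=
  z ∈ S ∧ IsMinOn f S z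

/-- The model-based constraints on `(Q, R, P, P₁)`. -/
def modelFeasible {n m : ℕ} (A : Matrix (Fin n) (Fin n) ℝ) (B : Matrix (Fin n) (Fin m) ℝ)
    (K : Matrix (Fin m) (Fin n) ℝ) : Set (Vars n m) :=
  {z | match z with
    | (Q, R, P, P₁) =>
      Q.PosSemidef ∧ P.PosSemidef ∧ R.PosDef ∧ P₁.PosDef ∧
      Q + Kᵀ * R * K + P * (A - B * K) + (A - B * K)ᵀ * P = 0 ∧
      (Q - P₁ * A - Aᵀ * P₁).PosDef}

/-- The model-based objective `‖R K - Bᵀ P‖_F`. -/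
def modelObjective {n m : ℕ} (B : Matrix (Fin n) (Fin m) ℝ) (K : Matrix (Fin m) (Fin n) ℝ) :
    Vars n m → ℝ
  | (_, R, P, _) => frobNorm (R * K - Bᵀ * P)

/-- The data-based constraints on `(Q, R, P, P₁)`. Since `Hx` has more columns than rows, a matrix
of the form `Hxᵀ * S * Hx` can be positive only on vectors outside the kernel of `Hx`. -/
def dataFeasible {n m N q M : ℕ} (D : ProgramData n m N q M) : Set (Vars n m) :=
  {z | match z with
    | (Q, R, P, P₁) =>
      Q.PosSemidef ∧ P.PosSemidef ∧ R.PosDef ∧ P₁.PosDef ∧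
      D.Xiᵀ * Q * D.Xi + D.Uᵀ * R * D.U + D.Xiᵀ * P * D.Xid + D.Xidᵀ * P * D.Xi = 0 ∧
      ∀ v : Fin N → ℝ, D.Hx *ᵥ v ≠ 0 →
        0 < v ⬝ᵥ ((D.Hxᵀ * Q * D.Hx - D.Hxᵀ * P₁ * D.HA - D.HAᵀ * P₁ * D.Hx) *ᵥ v)}

/-- The data-based objective. The closed-loop input samples are `U = -K Xi`, so that the matrix
inside the norm is `-(Huᵀ * (R * K - Bᵀ * P) * Xi)`. -/
def dataObjective {n m N q M : ℕ} (D : ProgramData n m N q M) : Vars n m → ℝ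
  | (_, R, P, _) => frobNorm (D.Huᵀ * R * D.U + D.Hxdᵀ * P * D.Xi - D.HAᵀ * P * D.Xi)

/-! ### Linear quadratic optimality -/

/-- The cost `∫₀^∞ (xᵀ Q x + uᵀ R u) dt`, with value in `[0, ∞]`. -/
def lqrCost {n m : ℕ} (Q : Matrix (Fin n) (Fin n) ℝ) (R : Matrix (Fin m) (Fin m) ℝ)
    (x : ℝ → Fin n → ℝ) (u : ℝ → Fin m → ℝ) : ℝ≥0∞ :=
  ∫⁻ t in Ici (0 : ℝ), ENNReal.ofReal (x t ⬝ᵥ (Q *ᵥ x t) + u t ⬝ᵥ (R *ᵥ u t))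

/-- The feedback `u = -K x` minimizes the cost with weights `Q`, `R` for every initial state,
among all locally integrable inputs on `[0, ∞)`. -/
def IsLQROptimal {n m : ℕ} (A : Matrix (Fin n) (Fin n) ℝ) (B : Matrix (Fin n) (Fin m) ℝ)
    (Q : Matrix (Fin n) (Fin n) ℝ) (R : Matrix (Fin m) (Fin m) ℝ)
    (K : Matrix (Fin m) (Fin n) ℝ) : Prop :=
  ∀ x : ℝ → Fin n → ℝ, (∀ b : ℝ, 0 ≤ b → IsTrajectory A B (fun t => -(K *ᵥ x t)) x b) →
    ∀ (v : ℝ → Fin m → ℝ) (y : ℝ → Fin n → ℝ), (∀ b : ℝ, 0 ≤ b → IsTrajectory A B v y b) →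
      y 0 = x 0 → lqrCost Q R x (fun t => -(K *ᵥ x t)) ≤ lqrCost Q R y v

end

end InverseLQR

open InverseLQR

open Filter Topology

namespace InverseLQR

/-! ### Flows of linear vector fields -/

section Flow

/-! All data matrices are linear images of the model. Closed-loop sampling gives `Xid = (A - B * K)
* Xi` and `U = -(K * Xi)`, and the open-loop experiment gives `Hxd = A * Hx + B * Hu`. So the
equality constraint is a congruence by `Xi` of the model equation, the inequality is the model form
evaluated at `Hx *ᵥ v`, and the matrix in the objective is `-(Huᵀ * (R * K - Bᵀ * P) * Xi)`. Once
`Xi`, `Hx` and `Hu` have right inverses, the feasible sets coincide and the two objectives have the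
same zeros (`dataFeasible_eq_modelFeasible`, `dataObjective_eq_zero_iff`). The objectives still
differ as functions, but the feasible set is stable under positive scaling and both objectives are
nonnegative and positively homogeneous, so minimizers are exactly feasible zeros
(`isSolution_iff_of_cone`).

Right inverses of `Hx` and `Hu` come from a dual form of Willems' lemma. A functional annihilating
the input-state data is carried by the transposed flow to the starts of the periods. Cayley-Hamilton
eliminates the state from `n + 1` shifted relations, and excitation of order `n + 1` leaves only
functionals unreachable for the sampled system (`left_kernel_of_persistently_exciting`). A
nonpathological period admits none but zero (`eq_zero_of_sampled_unreachable`).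

Feasibility needs only stability of `A - B * K`. For the last claim, comparing `K` with the gain
`R⁻¹ * (Bᵀ * P)` and completing the square gives `R * K = Bᵀ * P`. A suitable `P₁` exists because an
optimal `K` vanishes on the unobservable subspace of `(Q, A)`, which rules out the dual obstruction
produced by Hahn-Banach (`exists_strict_lmi`). -/

/-- The exponential series of an operator, applied to a vector. -/
theorem hasSum_exp_smul_apply {V : Type*} [NormedAddCommGroup V] [NormedSpace ℂ V]
    [CompleteSpace V] (L : V →L[ℂ] V) (t : ℝ) (v : V) :
    HasSum (fun k : ℕ => ((k.factorial : ℝ)⁻¹ * t ^ k) • (L ^ k) v)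
      (NormedSpace.exp (t • L) v) := by
  have h := NormedSpace.exp_series_hasSum_exp' (𝕂 := ℝ) (t • L)
  have h2 := (ContinuousLinearMap.apply ℂ V v).hasSum h
  have h3 : ∀ k : ℕ, ((k.factorial : ℝ)⁻¹ * t ^ k) • (L ^ k) v =
      ContinuousLinearMap.apply ℂ V v ((k.factorial : ℝ)⁻¹ • (t • L) ^ k) := fun k => by
    rw [smul_pow, smul_smul]; rfl
  simp_rw [h3]
  exact h2

theorem hasDerivAt_exp_smul_apply {V : Type*} [NormedAddCommGroup V] [NormedSpace ℂ V]
    [CompleteSpace V] (L : V →L[ℂ] V) (v : V) (t : ℝ) :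
    HasDerivAt (fun s : ℝ => NormedSpace.exp (s • L) v) (L (NormedSpace.exp (t • L) v)) t := by
  have h := hasDerivAt_exp_smul_const' L t
  exact ((ContinuousLinearMap.apply ℂ V v).restrictScalars ℝ).hasFDerivAt.comp_hasDerivAt t h

/-- Splitting `L` into the scalar `l` and the commuting remainder factors the exponential, and the
series of the remainder terminates at `v`. -/
theorem exp_smul_apply_of_pow_eq_zero {V : Type*} [NormedAddCommGroup V] [NormedSpace ℂ V]
    [CompleteSpace V] (L : V →L[ℂ] V) (l : ℂ) (t : ℝ) (v : V) (k : ℕ)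
    (h : ((L - l • (1 : V →L[ℂ] V)) ^ k) v = 0) :
    NormedSpace.exp (t • L) v = Complex.exp (t * l) •
      ∑ j ∈ Finset.range k,
        ((j.factorial : ℝ)⁻¹ * t ^ j) • ((L - l • (1 : V →L[ℂ] V)) ^ j) v := by
  set N := L - l • (1 : V →L[ℂ] V) with hN
  have e : t • L = t • N + algebraMap ℂ (V →L[ℂ] V) (t * l) := by
    ext x
    simp [hN, Algebra.algebraMap_eq_smul_one, smul_sub, mul_smul]
  let _ : NormedAlgebra ℚ (V →L[ℂ] V) := NormedAlgebra.restrictScalars ℚ ℂ (V →L[ℂ] V)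
  have h1 : NormedSpace.exp (t • L) v =
      Complex.exp (t * l) • NormedSpace.exp (t • N) v := by
    rw [e, NormedSpace.exp_add_of_commute (Algebra.commute_algebraMap_right _ _),
      ← NormedSpace.algebraMap_exp_comm]
    simp [Algebra.algebraMap_eq_smul_one, Complex.exp_eq_exp_ℂ]
  rw [h1, (hasSum_exp_smul_apply N t v).unique (hasSum_sum_of_ne_finset_zero ?_)]
  intro j hj
  have hj : k ≤ j := by simpa using hj
  obtain ⟨i, rfl⟩ := Nat.exists_eq_add_of_le' hj
  have h2 : (N ^ (i + k)) v = (N ^ i) ((N ^ k) v) := by rw [pow_add]; rfl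
  rw [h2, h, map_zero, smul_zero]

theorem tendsto_pow_mul_exp_of_re_neg (l : ℂ) (hl : l.re < 0) (j : ℕ) :
    Tendsto (fun t : ℝ => (t : ℂ) ^ j * Complex.exp (t * l)) atTop (𝓝 0) := by
  rw [tendsto_zero_iff_norm_tendsto_zero]
  have h := (Real.tendsto_pow_mul_exp_neg_atTop_nhds_zero j).comp
    (tendsto_id.const_mul_atTop (neg_pos.2 hl))
  have h := h.const_mul (((-l.re) ^ j)⁻¹)
  rw [mul_zero] at h
  refine h.congr' ?_
  filter_upwards [eventually_ge_atTop 0] with t ht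
  have : (-l.re) ^ j ≠ 0 := pow_ne_zero _ (neg_pos.2 hl).ne'
  simp only [Function.comp, id, norm_mul, norm_pow, Complex.norm_exp, Complex.norm_real,
    Real.norm_eq_abs, abs_of_nonneg ht, mul_pow]
  simp
  field_simp

/-- Generalized eigenvectors span the space, and on each of them the flow is a polynomial in `t`
times a decaying exponential. -/
theorem tendsto_exp_smul_apply {V : Type*} [NormedAddCommGroup V] [NormedSpace ℂ V]
    [FiniteDimensional ℂ V] [CompleteSpace V] (L : V →L[ℂ] V)
    (hL : ∀ l, Module.End.HasEigenvalue (L : Module.End ℂ V) l → l.re < 0) (v : V) :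
    Tendsto (fun t : ℝ => NormedSpace.exp (t • L) v) atTop (𝓝 0) := by
  have hv : v ∈ ⨆ l, Module.End.maxGenEigenspace (L : Module.End ℂ V) l := by
    rw [Module.End.iSup_maxGenEigenspace_eq_top]; trivial
  induction hv using Submodule.iSup_induction' with
  | zero => simp
  | add x y _ _ hx hy => simpa using hx.add hy
  | mem l x hx =>
    by_cases hx0 : x = 0
    · simp [hx0]
    obtain ⟨k, hk⟩ := Module.End.mem_maxGenEigenspace _ _ _ |>.1 hx
    -- A nonzero generalized eigenvector makes `l` an eigenvalue: otherwise `L - l` and all its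
    -- powers would be injective.
    have hl : l.re < 0 := by
      refine hL l fun hb => hx0 ?_
      have hb : LinearMap.ker ((L : Module.End ℂ V) - l • 1 : Module.End ℂ V) = ⊥ := by
        rw [← Module.End.eigenspace_def]; exact hb
      have hb : Function.Injective ((L : Module.End ℂ V) - l • 1 : Module.End ℂ V) :=
        LinearMap.ker_eq_bot.1 hb
      have h2 : Function.Injective (((L : Module.End ℂ V) - l • 1) ^ k : Module.End ℂ V) := by
        rw [Module.End.coe_pow]; exact hb.iterate k
      exact h2 (by rw [hk, map_zero])
    have hk' : ((L - l • (1 : V →L[ℂ] V)) ^ k) x = 0 := by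
      rw [← hk]
      have h2 : ((L : Module.End ℂ V) - l • 1 : Module.End ℂ V) =
        ((L - l • (1 : V →L[ℂ] V) : V →L[ℂ] V) : Module.End ℂ V) := rfl
      rw [h2, Module.End.coe_pow]
      exact congrFun (FunLike.coe_pow_eq_iterate _ k) x
    simp_rw [exp_smul_apply_of_pow_eq_zero L l _ x k hk', Finset.smul_sum]
    rw [← Finset.sum_const_zero (s := Finset.range k)]
    refine tendsto_finsetSum _ fun j _ => ?_
    have h := (tendsto_pow_mul_exp_of_re_neg l hl j).smul_const
      ((j.factorial : ℂ)⁻¹ • ((L - l • (1 : V →L[ℂ] V)) ^ j) x)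
    rw [zero_smul] at h
    refine h.congr fun t => ?_
    rw [← Complex.coe_smul, smul_smul, smul_smul]
    congr 1
    push_cast
    ring

end Flow

/-! ### The dual complex flow -/

section Dual

variable {n m : ℕ}

/-- The complexification of a real vector. -/
def complexify {d : ℕ} (x : Fin d → ℝ) : Fin d → ℂ := fun i => (x i : ℂ)

/-- The transpose of a real matrix, as an operator on complex vectors. -/
noncomputable def dualOp (A : Matrix (Fin n) (Fin n) ℝ) : (Fin n → ℂ) →L[ℂ] (Fin n → ℂ) :=
  LinearMap.toContinuousLinearMap (Matrix.toLin' (A.map (algebraMap ℝ ℂ))ᵀ)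

theorem dualOp_apply (A : Matrix (Fin n) (Fin n) ℝ) (w : Fin n → ℂ) :
    dualOp A w = (A.map (algebraMap ℝ ℂ))ᵀ *ᵥ w := rfl

theorem complexify_add {d : ℕ} (x y : Fin d → ℝ) :
    complexify (x + y) = complexify x + complexify y := by
  ext i; simp [complexify]

theorem complexify_mulVec {d e : ℕ} (A : Matrix (Fin d) (Fin e) ℝ) (x : Fin e → ℝ) :
    complexify (A *ᵥ x) = A.map (algebraMap ℝ ℂ) *ᵥ complexify x := by
  ext i; simp [complexify, mulVec, dotProduct]

theorem dualOp_dotProduct (A : Matrix (Fin n) (Fin n) ℝ) (w : Fin n → ℂ) (x : Fin n → ℝ) :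
    dualOp A w ⬝ᵥ complexify x = w ⬝ᵥ complexify (A *ᵥ x) := by
  rw [dualOp_apply, complexify_mulVec, mulVec_transpose, dotProduct_mulVec]

theorem isEigenvalue_of_hasEigenvalue_dualOp (A : Matrix (Fin n) (Fin n) ℝ) (l : ℂ)
    (h : Module.End.HasEigenvalue (dualOp A : Module.End ℂ (Fin n → ℂ)) l) : IsEigenvalue A l := by
  have h2 : (dualOp A : Module.End ℂ (Fin n → ℂ)) =
    Matrix.toLin' (A.map (algebraMap ℝ ℂ))ᵀ := rfl
  rw [h2, Module.End.hasEigenvalue_iff_isRoot_charpoly, Matrix.charpoly_toLin',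
    Matrix.charpoly_transpose] at h
  rw [IsEigenvalue, Module.End.hasEigenvalue_iff_isRoot_charpoly, Matrix.charpoly_toLin']
  exact h

theorem IsEigenvalue.conj {A : Matrix (Fin n) (Fin n) ℝ} {l : ℂ} (h : IsEigenvalue A l) :
    IsEigenvalue A (starRingEnd ℂ l) := by
  obtain ⟨v, hv⟩ := h.exists_hasEigenvector
  have hv1 : A.map (algebraMap ℝ ℂ) *ᵥ v = l • v := hv.apply_eq_smul
  refine Module.End.hasEigenvalue_of_hasEigenvector (x := star v) ⟨?_, ?_⟩
  · rw [Module.End.mem_eigenspace_iff]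
    have h2 := congrArg star hv1
    ext i
    have h3 := congrFun h2 i
    simpa [mulVec, dotProduct] using h3
  · exact fun h0 => hv.2 (star_eq_zero.1 h0)

theorem hasDerivWithinAt_dotProduct {d : ℕ} {f g : ℝ → Fin d → ℂ} {f' g' : Fin d → ℂ} {s : Set ℝ}
    {t : ℝ} (hf : HasDerivWithinAt f f' s t) (hg : HasDerivWithinAt g g' s t) :
    HasDerivWithinAt (fun r => f r ⬝ᵥ g r) (f' ⬝ᵥ g t + f t ⬝ᵥ g') s t := by
  rw [hasDerivWithinAt_pi] at hf hg
  have := HasDerivWithinAt.fun_sum (u := Finset.univ) fun i _ => (hf i).mul (hg i)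
  simpa [dotProduct, Finset.sum_add_distrib] using this

theorem hasDerivWithinAt_complexify {d : ℕ} {x : ℝ → Fin d → ℝ} {x' : Fin d → ℝ} {s : Set ℝ}
    {t : ℝ} (hx : HasDerivWithinAt x x' s t) :
    HasDerivWithinAt (fun r => complexify (x r)) (complexify x') s t := by
  rw [hasDerivWithinAt_pi] at hx ⊢
  exact fun i => (hx i).ofReal_comp

/-- Duality between an affine system and the flow of the transposed matrix. -/
theorem dotProduct_trajectory {A : Matrix (Fin n) (Fin n) ℝ} {c : Fin n → ℝ} {x : ℝ → Fin n → ℝ}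
    {a b : ℝ} (hx : ∀ s ∈ Icc a b, HasDerivWithinAt x (A *ᵥ x s + c) (Icc a b) s)
    (w : Fin n → ℂ) {s : ℝ} (hs : s ∈ Icc a b) :
    w ⬝ᵥ complexify (x s) = NormedSpace.exp ((s - a) • dualOp A) w ⬝ᵥ complexify (x a) +
      (∫ r in (0 : ℝ)..(s - a), NormedSpace.exp (r • dualOp A) w) ⬝ᵥ complexify c := by
  set L := dualOp A with hL
  have hE := hasDerivAt_exp_smul_apply L w
  have hEc : Continuous fun r : ℝ => NormedSpace.exp (r • L) w :=
    continuous_iff_continuousAt.2 fun r => (hE r).continuousAt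
  -- Pairing the state with the backward dual flow cancels the terms in `A`, so only the constant
  -- forcing `c` is left to integrate.
  have hder : ∀ r ∈ Icc a s, HasDerivWithinAt
      (fun r => NormedSpace.exp ((s - r) • L) w ⬝ᵥ complexify (x r))
      (NormedSpace.exp ((s - r) • L) w ⬝ᵥ complexify c) (Icc a s) r := by
    intro r hr
    have h1 : HasDerivAt (fun r : ℝ => NormedSpace.exp ((s - r) • L) w)
        (-(L (NormedSpace.exp ((s - r) • L) w))) r := by
      exact ((hE (s - r)).scomp r ((hasDerivAt_id r).const_sub s)).congr_deriv (by simp)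
    have h2 := hasDerivWithinAt_complexify
      ((hx r ⟨hr.1, hr.2.trans hs.2⟩).mono (Icc_subset_Icc_right hs.2))
    have h3 := hasDerivWithinAt_dotProduct h1.hasDerivWithinAt h2
    convert h3 using 1
    rw [complexify_add, dotProduct_add, ← dualOp_dotProduct, neg_dotProduct]
    ring
  have hcont : Continuous fun r : ℝ => NormedSpace.exp ((s - r) • L) w ⬝ᵥ complexify c := by
    have := hEc.comp (continuous_const.sub continuous_id : Continuous fun r : ℝ => s - r)
    exact Continuous.dotProduct this continuous_const
  have hint := intervalIntegral.integral_eq_sub_of_hasDerivAt_of_le hs.1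
    (fun r hr => (hder r hr).continuousWithinAt)
    (fun r hr => (hder r (Ioo_subset_Icc_self hr)).hasDerivAt (Icc_mem_nhds hr.1 hr.2))
    (hcont.intervalIntegrable a s)
  have h4 : ∫ r in a..s, NormedSpace.exp ((s - r) • L) w ⬝ᵥ complexify c =
      (∫ r in (0 : ℝ)..(s - a), NormedSpace.exp (r • L) w) ⬝ᵥ complexify c := by
    rw [intervalIntegral.integral_comp_sub_left
      (fun r => NormedSpace.exp (r • L) w ⬝ᵥ complexify c) s, sub_self]
    let φ : (Fin n → ℂ) →L[ℂ] ℂ :=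
      LinearMap.toContinuousLinearMap ((dotProductBilin ℂ ℂ).flip (complexify c))
    exact φ.intervalIntegral_comp_comm (hEc.intervalIntegrable _ _)
  have h5 : NormedSpace.exp ((0 : ℝ) • L) w = w := by
    rw [show (0 : ℝ) • L = 0 from zero_smul ℝ L, NormedSpace.exp_zero]; rfl
  rw [h4, sub_self, h5] at hint
  rw [hint]
  simp

/-- Trajectories of a stable autonomous system decay. -/
theorem tendsto_zero_of_eigenvalues_re_neg {A : Matrix (Fin n) (Fin n) ℝ}
    (hA : ∀ z, IsEigenvalue A z → z.re < 0) {x : ℝ → Fin n → ℝ}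
    (hx : ∀ t, HasDerivAt x (A *ᵥ x t) t) : Tendsto x atTop (𝓝 0) := by
  rw [tendsto_pi_nhds]
  intro i
  have hd := tendsto_exp_smul_apply (dualOp A)
    (fun l hl => hA l (isEigenvalue_of_hasEigenvalue_dualOp A l hl)) (Pi.single i 1)
  have h1 : Tendsto (fun t : ℝ => NormedSpace.exp (t • dualOp A) (Pi.single i 1) ⬝ᵥ
      complexify (x 0)) atTop (𝓝 0) := by
    have h2 : Continuous fun w : Fin n → ℂ => w ⬝ᵥ complexify (x 0) :=
      continuous_id.dotProduct continuous_const
    have h3 := (h2.tendsto 0).comp hd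
    rw [zero_dotProduct] at h3
    exact h3
  have h3 := (Complex.continuous_re.tendsto 0).comp h1
  refine h3.congr' ?_
  filter_upwards [eventually_ge_atTop 0] with t ht
  have h4 := dotProduct_trajectory (A := A) (c := 0) (x := x) (a := 0) (b := t)
    (fun s _ => by simpa using (hx s).hasDerivWithinAt) (Pi.single i 1) (right_mem_Icc.2 ht)
  have h5 : complexify (0 : Fin n → ℝ) = 0 := by ext; simp [complexify]
  rw [h5, dotProduct_zero, add_zero, sub_zero] at h4
  simp only [Function.comp]
  rw [← h4]
  simp [complexify]

end Dual

/-! ### Full row rank -/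

section Rank

theorem eq_zero_of_vecMul_eq_zero {ι κ : Type*} [Fintype ι] [Fintype κ] {M : Matrix ι κ ℝ}
    (hM : M.rank = Fintype.card ι) {v : ι → ℝ} (hv : v ᵥ* M = 0) : v = 0 := by
  have hli : LinearIndependent ℝ M.row := by
    rw [linearIndependent_iff_card_eq_finrank_span, ← hM, rank_eq_finrank_span_row]; rfl
  exact vecMul_injective_iff.2 hli (by simpa using hv)

theorem eq_zero_of_sum_mul_ofReal_eq_zero {ι κ : Type*} [Fintype ι] [Fintype κ]
    {M : Matrix ι κ ℝ} (hM : M.rank = Fintype.card ι) {v : ι → ℂ}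
    (hv : ∀ j, ∑ i, v i * (M i j : ℂ) = 0) : v = 0 := by
  have h1 : (fun i => (v i).re) = 0 := eq_zero_of_vecMul_eq_zero hM <| by
    ext j; simpa [vecMul, dotProduct] using congrArg Complex.re (hv j)
  have h2 : (fun i => (v i).im) = 0 := eq_zero_of_vecMul_eq_zero hM <| by
    ext j; simpa [vecMul, dotProduct] using congrArg Complex.im (hv j)
  ext i
  exact Complex.ext (congrFun h1 i) (congrFun h2 i)

/-- The transpose is injective and hence has a left inverse. The resulting right inverse is what
later cancels a data matrix from a congruence. -/
theorem exists_mul_eq_one_of_vecMul {ι κ : Type*} [Fintype ι] [Fintype κ] [DecidableEq ι]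
    {M : Matrix ι κ ℝ}
    (hM : ∀ v, v ᵥ* M = 0 → v = 0) : ∃ N : Matrix κ ι ℝ, M * N = 1 := by
  have hinj : LinearMap.ker Mᵀ.mulVecLin = ⊥ := LinearMap.ker_eq_bot'.2 fun v hv =>
    hM v (by rw [← mulVec_transpose]; exact hv)
  classical
  obtain ⟨g, hg⟩ := LinearMap.exists_leftInverse_of_injective _ hinj
  refine ⟨(LinearMap.toMatrix' g)ᵀ, ?_⟩
  have h := congrArg LinearMap.toMatrix' hg
  rw [← toLin'_apply', LinearMap.toMatrix'_comp, LinearMap.toMatrix'_toLin',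
    LinearMap.toMatrix'_id] at h
  rw [← transpose_transpose M, ← transpose_mul, h, transpose_one]

theorem eq_zero_of_controllable {n m : ℕ} {A : Matrix (Fin n) (Fin n) ℝ}
    {B : Matrix (Fin n) (Fin m) ℝ} (hAB : Controllable A B) {v : Fin n → ℂ}
    (hv : ∀ (k : ℕ) (c : Fin m), ∑ i, v i * (((A ^ k * B) i c : ℝ) : ℂ) = 0) : v = 0 :=
  eq_zero_of_sum_mul_ofReal_eq_zero (hAB.trans (Fintype.card_fin n).symm) fun p => hv p.1 p.2

/-- The `h j` are the blocks of a row vector annihilating a matrix of full row rank. The bound `i +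
L < N + 1` says that `i` is a column index, and is safe against truncated subtraction. -/
theorem eq_zero_of_blockHankel {m N L : ℕ} {μ : ℕ → Fin m → ℝ}
    (hμ : (blockHankel μ N L).rank = m * L) {h : ℕ → Fin m → ℂ}
    (hh : ∀ i, i + L < N + 1 → ∑ j ∈ Finset.range L, h j ⬝ᵥ complexify (μ (i + j)) = 0)
    {j : ℕ} (hj : j < L) : h j = 0 := by
  have h1 : (fun p : Fin L × Fin m => h p.1 p.2) = 0 := by
    refine eq_zero_of_sum_mul_ofReal_eq_zero (M := blockHankel μ N L) ?_ fun i => ?_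
    · rw [hμ]; simp [mul_comm]
    · rw [Fintype.sum_prod_type, ← hh i (by omega), Finset.sum_range]
      simp [blockHankel, dotProduct, complexify, add_comm]
  ext c
  exact congrFun h1 (⟨j, hj⟩, c)

end Rank

/-! ### Persistency of excitation in discrete time -/

section Willems

/-- Discrete variation of constants in dual form: the functional moves backwards in time, so no
state matrix is needed. -/
theorem dotProduct_iterate {n m N : ℕ} {F : Module.End ℂ (Fin n → ℂ)}
    {b : (Fin n → ℂ) →ₗ[ℂ] (Fin m → ℂ)} {X : ℕ → Fin n → ℂ} {U : ℕ → Fin m → ℂ}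
    (hstep : ∀ i < N, ∀ w, w ⬝ᵥ X (i + 1) = F w ⬝ᵥ X i + b w ⬝ᵥ U i)
    (k i : ℕ) (hk : i + k ≤ N) (w : Fin n → ℂ) :
    w ⬝ᵥ X (i + k) = (F ^ k) w ⬝ᵥ X i +
      ∑ j ∈ Finset.range k, b ((F ^ (k - 1 - j)) w) ⬝ᵥ U (i + j) := by
  induction k generalizing w with
  | zero => simp
  | succ k ih =>
    rw [← add_assoc, hstep (i + k) (by omega) w, ih (by omega), Finset.sum_range_succ, add_assoc]
    congr 2
    refine Finset.sum_congr rfl fun j hj => ?_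
    · have : k + 1 - 1 - j = (k - 1 - j) + 1 := by have := Finset.mem_range.1 hj; omega
      rw [this, pow_succ]; rfl
    · simp

/-- The left kernel of the stacked input-state data of a persistently exciting experiment
consists of unreachable functionals. -/
theorem left_kernel_of_persistently_exciting {n m N : ℕ} {F : Module.End ℂ (Fin n → ℂ)}
    {b : (Fin n → ℂ) →ₗ[ℂ] (Fin m → ℂ)} {X : ℕ → Fin n → ℂ} {U : ℕ → Fin m → ℂ}
    (hstep : ∀ i < N, ∀ w, w ⬝ᵥ X (i + 1) = F w ⬝ᵥ X i + b w ⬝ᵥ U i)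
    (hPE : ∀ h : ℕ → Fin m → ℂ,
      (∀ i, i + n < N → ∑ j ∈ Finset.range (n + 1), h j ⬝ᵥ U (i + j) = 0) → ∀ j ≤ n, h j = 0)
    {w : Fin n → ℂ} {η : Fin m → ℂ} (hw : ∀ i < N, w ⬝ᵥ X i + η ⬝ᵥ U i = 0) :
    η = 0 ∧ ∀ k, b ((F ^ k) w) = 0 := by
  set c : ℕ → ℂ := fun k => F.charpoly.coeff k with hc
  have hdeg : F.charpoly.natDegree = n := by simp [LinearMap.charpoly_natDegree]
  have hcn : c n = 1 := by
    have := F.charpoly_monic.coeff_natDegree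
    rwa [hdeg] at this
  have hCH : ∑ k ∈ Finset.range (n + 1), c k • (F ^ k) w = 0 := by
    have h := congrArg (fun f : Module.End ℂ (Fin n → ℂ) => f w) F.aeval_self_charpoly
    rw [Polynomial.aeval_eq_sum_range, hdeg] at h
    simpa using h
  -- Weight the relations at the times `i, ..., i + n` by the coefficients of the characteristic
  -- polynomial. Cayley-Hamilton removes the state `X i`, and `h j` collects what multiplies the
  -- input `U (i + j)`.
  set h : ℕ → Fin m → ℂ := fun j => c j • η +
    ∑ k ∈ Finset.range (n + 1), if j < k then c k • b ((F ^ (k - 1 - j)) w) else 0 with hh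
  have h0 : ∀ j ≤ n, h j = 0 := by
    refine hPE h fun i hi => ?_
    have h1 : ∑ k ∈ Finset.range (n + 1), c k * (w ⬝ᵥ X (i + k) + η ⬝ᵥ U (i + k)) = 0 :=
      Finset.sum_eq_zero fun k hk => by
        have := Finset.mem_range.1 hk
        rw [hw _ (by omega), mul_zero]
    have h2 : ∀ k ∈ Finset.range (n + 1), c k * (w ⬝ᵥ X (i + k) + η ⬝ᵥ U (i + k)) =
        (c k • (F ^ k) w) ⬝ᵥ X i + (c k • η) ⬝ᵥ U (i + k) +
        ∑ j ∈ Finset.range (n + 1),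
          (if j < k then c k • b ((F ^ (k - 1 - j)) w) else 0) ⬝ᵥ U (i + j) := by
      intro k hk
      have := Finset.mem_range.1 hk
      rw [dotProduct_iterate hstep k i (by omega) w]
      have h3 : ∑ j ∈ Finset.range (n + 1),
          (if j < k then c k • b ((F ^ (k - 1 - j)) w) else 0) ⬝ᵥ U (i + j) =
          ∑ j ∈ Finset.range k, (c k • b ((F ^ (k - 1 - j)) w)) ⬝ᵥ U (i + j) := by
        rw [← Finset.sum_subset (Finset.range_mono (show k ≤ n + 1 by omega))]
        · exact Finset.sum_congr rfl fun j hj => by rw [if_pos (Finset.mem_range.1 hj)]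
        · intro j _ hj
          rw [if_neg (by simpa using hj), zero_dotProduct]
      rw [h3]
      simp only [smul_dotProduct, smul_eq_mul, ← Finset.mul_sum]
      ring
    rw [Finset.sum_congr rfl h2, Finset.sum_add_distrib, Finset.sum_add_distrib,
      ← sum_dotProduct, hCH, zero_dotProduct, zero_add, Finset.sum_comm,
      ← Finset.sum_add_distrib] at h1
    rw [← h1]
    refine Finset.sum_congr rfl fun j _ => ?_
    rw [hh, add_dotProduct, sum_dotProduct]
  -- The last block has no index `k > n` and the leading coefficient is one, so `h n` is `η` itself.
  have hη : η = 0 := by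
    have h1 := h0 n le_rfl
    simp only [hh, hcn, one_smul] at h1
    rwa [Finset.sum_eq_zero, add_zero] at h1
    intro k hk
    have := Finset.mem_range.1 hk
    rw [if_neg (by omega)]
  -- With `η = 0`, the block `n - 1 - l` is `b (F ^ l w)` plus terms with lower powers of `F`, which
  -- vanish by induction.
  have hlt : ∀ l < n, b ((F ^ l) w) = 0 := by
    intro l
    induction l using Nat.strong_induction_on with
    | _ l ih =>
      intro hl
      have h1 := h0 (n - 1 - l) (by omega)
      simp only [hh, hη, smul_zero, zero_add] at h1
      rw [Finset.sum_eq_single n] at h1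
      · rw [if_pos (by omega), hcn, one_smul] at h1
        rwa [show n - 1 - (n - 1 - l) = l by omega] at h1
      · intro k hk hkn
        have := Finset.mem_range.1 hk
        split_ifs with hlk
        · rw [ih _ (by omega) (by omega), smul_zero]
        · rfl
      · simp
  refine ⟨hη, fun k => ?_⟩
  rw [LinearMap.pow_eq_aeval_mod_charpoly]
  -- For `n = 0` the remainder has `natDegree` zero, so the strict degree bound used below would
  -- fail.
  rcases Nat.eq_zero_or_pos n with rfl | hn
  · rw [Subsingleton.elim ((Polynomial.aeval F) _ w) 0, map_zero]
  have hd : (Polynomial.X ^ k %ₘ F.charpoly).natDegree < n := by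
    refine (Polynomial.natDegree_modByMonic_lt _ F.charpoly_monic fun h1 => ?_).trans_eq hdeg
    rw [h1, Polynomial.natDegree_one] at hdeg
    omega
  rw [Polynomial.aeval_eq_sum_range' hd, LinearMap.sum_apply, map_sum]
  refine Finset.sum_eq_zero fun i hi => ?_
  rw [LinearMap.smul_apply, map_smul, hlt i (Finset.mem_range.1 hi), smul_zero]

end Willems

/-! ### Sampling -/

section Sampling

/-- If the exponential is injective on the spectrum, an eigenvector of `exp (T L)` is an
eigenvector of `L`. -/
theorem exists_eigenvalue_of_exp_smul_apply {V : Type*} [NormedAddCommGroup V] [NormedSpace ℂ V]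
    [FiniteDimensional ℂ V] [CompleteSpace V] (L : V →L[ℂ] V) {T : ℝ} (hT : 0 < T)
    (hinj : ∀ z w, Module.End.HasEigenvalue (L : Module.End ℂ V) z →
      Module.End.HasEigenvalue (L : Module.End ℂ V) w →
      Complex.exp (T * z) = Complex.exp (T * w) → z = w)
    {l : ℂ} {v : V} (hv : v ≠ 0) (hlv : NormedSpace.exp (T • L) v = l • v) :
    ∃ z, Module.End.HasEigenvalue (L : Module.End ℂ V) z ∧ L v = z • v := by
  set F := NormedSpace.exp (T • L) with hF
  have hcomm : ∀ x, F (L x) = L (F x) := by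
    let _ : NormedAlgebra ℚ (V →L[ℂ] V) := NormedAlgebra.restrictScalars ℚ ℂ (V →L[ℂ] V)
    have h : Commute F L := Commute.exp_left ((Commute.refl L).smul_left T)
    exact fun x => congrArg (fun f : V →L[ℂ] V => f x) h.eq
  have hstab : ∀ (z : ℂ) (x : V), F x = l • x → F (L x - z • x) = l • (L x - z • x) := by
    intro z x hx
    rw [map_sub, map_smul, hcomm, hx, map_smul, smul_sub, smul_comm]
  -- There are no Jordan blocks inside an eigenspace of `F`. If `N ^ 2` kills `y` but `N` does not,
  -- the eigenvalue read off at `N y` is `exp (T z)`, and then `F y` contains an extra term `T • N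
  -- y` that must vanish.
  have hker : ∀ (z : ℂ) (k : ℕ) (x : V), F x = l • x →
      ((L - z • (1 : V →L[ℂ] V)) ^ (k + 1)) x = 0 → L x = z • x := by
    intro z k
    set N := L - z • (1 : V →L[ℂ] V) with hN
    have hNx : ∀ x, N x = L x - z • x := fun x => rfl
    have hpow : ∀ k x, (N ^ (k + 1)) x = N ((N ^ k) x) := fun k x => by rw [pow_succ']; rfl
    have hNk : ∀ k x, F x = l • x → F ((N ^ k) x) = l • (N ^ k) x := by
      intro k x hx
      induction k with
      | zero => simpa using hx
      | succ k ih => rw [hpow, hNx]; exact hstab z _ ih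
    induction k with
    | zero => intro x _ h; simpa [hNx, sub_eq_zero] using h
    | succ k ih =>
      intro x hx h
      refine ih x hx ?_
      set y := (N ^ k) x with hy
      have hy0 : (N ^ 2) y = 0 := by
        rw [← h, hy, add_assoc, add_comm, pow_add]; rfl
      have hFy := hNk k x hx
      have hFNy := hNk (k + 1) x hx
      have e1 := exp_smul_apply_of_pow_eq_zero L z T y 2 hy0
      have e2 := exp_smul_apply_of_pow_eq_zero L z T (N y) 1
        (by rw [pow_one]; rw [pow_two] at hy0; exact hy0)
      rw [hpow] at hFNy ⊢
      rw [← hF] at e1 e2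
      rw [hFy] at e1
      rw [hFNy] at e2
      simp only [Finset.sum_range_succ, Finset.sum_range_zero, pow_zero, pow_one] at e1 e2
      by_contra hne
      have hexp : l = Complex.exp (T * z) := by
        have : (l - Complex.exp (T * z)) • N y = 0 := by
          rw [sub_smul, e2, sub_eq_zero]; simp
        exact sub_eq_zero.1 ((smul_eq_zero.1 this).resolve_right hne)
      rw [hexp] at e1
      have e3 := smul_right_injective V (Complex.exp_ne_zero (T * z)) e1
      have e4 : y = y + T • N y := e3.trans (by simp [hNx])
      have e4 : T • N y = 0 := left_eq_add.1 e4
      exact hne ((smul_eq_zero.1 e4).resolve_left hT.ne')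
  -- `L` acts on the `l`-eigenspace of `F`, without Jordan blocks there. All its eigenvalues on it
  -- have the same exponential `l`, so by injectivity there is only one and `L` is scalar on `W`.
  let W : Submodule ℂ V := Module.End.eigenspace (F : Module.End ℂ V) l
  have hW : ∀ x, x ∈ W ↔ F x = l • x := fun x => Module.End.mem_eigenspace_iff
  have hWL : ∀ x ∈ W, (L : Module.End ℂ V) x ∈ W := by
    intro x hx
    rw [hW] at hx ⊢
    simpa using hstab 0 x hx
  let M : Module.End ℂ W := (L : Module.End ℂ V).restrict hWL
  have hMc : ∀ x : W, ((M x : W) : V) = L x := fun x => rfl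
  have hgen : ∀ (z : ℂ) (x : W), x ∈ M.maxGenEigenspace z → L (x : V) = z • (x : V) := by
    intro z x hx
    obtain ⟨k, hk⟩ := (Module.End.mem_maxGenEigenspace _ _ _).1 hx
    have hc : ∀ k, (((((M - z • (1 : Module.End ℂ W)) ^ k) x : W)) : V) =
        ((L - z • (1 : V →L[ℂ] V)) ^ k) x := by
      intro k
      induction k with
      | zero => rfl
      | succ k ih => rw [pow_succ', pow_succ']; simp [hMc, ih]
    refine hker z k x ((hW _).1 x.2) ?_
    have : ((L - z • (1 : V →L[ℂ] V)) ^ k) (x : V) = 0 := by rw [← hc, hk]; rfl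
    rw [pow_succ']
    show (L - z • (1 : V →L[ℂ] V)) (((L - z • (1 : V →L[ℂ] V)) ^ k) (x : V)) = 0
    rw [this, map_zero]
  let v' : W := ⟨v, (hW v).2 hlv⟩
  have : Nontrivial W := ⟨v', 0, fun h => hv (congrArg Subtype.val h)⟩
  have heig : ∀ (z : ℂ) (x : W), x ≠ 0 → L (x : V) = z • (x : V) →
      Module.End.HasEigenvalue (L : Module.End ℂ V) z ∧ Complex.exp (T * z) = l := by
    intro z x hx hz
    have hx' : (x : V) ≠ 0 := fun h => hx (Subtype.ext h)
    refine ⟨Module.End.hasEigenvalue_of_hasEigenvector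
      ⟨Module.End.mem_eigenspace_iff.2 hz, hx'⟩, ?_⟩
    have e := exp_smul_apply_of_pow_eq_zero L z T x 1 (by simp [hz])
    rw [← hF, (hW x).1 x.2] at e
    have : (Complex.exp (T * z) - l) • (x : V) = 0 := by
      rw [sub_smul, e, sub_eq_zero]; simp
    exact sub_eq_zero.1 ((smul_eq_zero.1 this).resolve_right hx')
  obtain ⟨z, hz⟩ := Module.End.exists_eigenvalue M
  obtain ⟨e, he⟩ := hz.exists_hasEigenvector
  have hez : L (e : V) = z • (e : V) := congrArg Subtype.val he.apply_eq_smul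
  obtain ⟨hz1, hz2⟩ := heig z e he.2 hez
  refine ⟨z, hz1, ?_⟩
  have hall : ∀ x : W, L (x : V) = z • (x : V) := by
    intro x
    have hx : x ∈ ⨆ r, M.maxGenEigenspace r := by
      rw [Module.End.iSup_maxGenEigenspace_eq_top]; trivial
    induction hx using Submodule.iSup_induction' with
    | zero => simp
    | add x y _ _ hx hy => simp [hx, hy]
    | mem r x hx =>
      by_cases hx0 : x = 0
      · simp [hx0]
      have hr := hgen r x hx
      obtain ⟨hr1, hr2⟩ := heig r x hx0 hr
      rw [hr, hinj r z hr1 hz1 (hr2.trans hz2.symm)]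
  exact hall v'

variable {n m : ℕ} {A : Matrix (Fin n) (Fin n) ℝ} {T : ℝ}

/-- Equal exponentials force equal real parts and imaginary parts differing by a multiple of `2 π /
T`, which the period condition excludes unless the multiple is zero. The sign hidden by the absolute
value is absorbed in `k`. -/
theorem NonpathologicalPeriod.exp_injOn (hA : NonpathologicalPeriod A T) (hT : 0 < T) {z w : ℂ}
    (hz : IsEigenvalue A z) (hw : IsEigenvalue A w)
    (h : Complex.exp (T * z) = Complex.exp (T * w)) : z = w := by
  obtain ⟨k, hk⟩ := Complex.exp_eq_exp_iff_exists_int.1 h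
  have hre : T * z.re = T * w.re := by simpa using congrArg Complex.re hk
  have him : T * z.im = T * w.im + k * (2 * Real.pi) := by simpa using congrArg Complex.im hk
  refine Complex.ext (mul_left_cancel₀ hT.ne' hre) ?_
  by_contra hne
  have hne' : (z - w).im ≠ 0 := by rw [Complex.sub_im]; exact sub_ne_zero.2 hne
  have habs := abs_pos.2 hne'
  have heq : T * (z - w).im = 2 * Real.pi * k := by rw [Complex.sub_im]; linarith
  rcases abs_choice (z - w).im with h1 | h1
  · refine hA z w hz hw hne' k ?_
    rw [eq_div_iff habs.ne', h1, heq]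
  · refine hA z w hz hw hne' (-k) ?_
    rw [eq_div_iff habs.ne', h1]
    push_cast
    linarith

/-- For `z ≠ 0` a zero integral means `exp (T z) = 1`. The conjugate eigenvalue has the same
exponential, so injectivity makes `z` real, and then it is zero. -/
theorem NonpathologicalPeriod.integral_exp_ne_zero (hA : NonpathologicalPeriod A T) (hT : 0 < T)
    {z : ℂ} (hz : IsEigenvalue A z) : ∫ r in (0 : ℝ)..T, Complex.exp (r * z) ≠ 0 := by
  by_cases h0 : z = 0
  · simp [h0, hT.ne']
  intro h
  simp_rw [mul_comm _ z] at h
  rw [integral_exp_mul_complex h0, div_eq_zero_iff, or_iff_left h0, sub_eq_zero] at h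
  have h1 : Complex.exp (T * z) = 1 := by rw [mul_comm, h]; simp
  have h2 : Complex.exp (T * starRingEnd ℂ z) = 1 := by
    have := congrArg (starRingEnd ℂ) h1
    rwa [← Complex.exp_conj, map_mul, Complex.conj_ofReal, map_one] at this
  have h3 := hA.exp_injOn hT hz hz.conj (h1.trans h2.symm)
  obtain ⟨r, rfl⟩ := Complex.conj_eq_iff_real.1 h3.symm
  have h4 : Real.exp (T * r) = 1 := by exact_mod_cast h1
  rw [Real.exp_eq_one_iff] at h4
  exact h0 (by exact_mod_cast (mul_eq_zero.1 h4).resolve_left hT.ne')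

/-- The dual of the input matrix of the sampled system. -/
noncomputable def dualInput (A : Matrix (Fin n) (Fin n) ℝ) (B : Matrix (Fin n) (Fin m) ℝ) (T : ℝ) :
    (Fin n → ℂ) →ₗ[ℂ] (Fin m → ℂ) :=
  Matrix.toLin' (B.map (algebraMap ℝ ℂ))ᵀ ∘ₗ
    ((∫ r in (0 : ℝ)..T, NormedSpace.exp (r • dualOp A) : (Fin n → ℂ) →L[ℂ] (Fin n → ℂ)) :
      (Fin n → ℂ) →ₗ[ℂ] (Fin n → ℂ))

theorem continuous_exp_smul_dualOp (A : Matrix (Fin n) (Fin n) ℝ) :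
    Continuous fun r : ℝ => NormedSpace.exp (r • dualOp A) :=
  continuous_iff_continuousAt.2 fun r => (hasDerivAt_exp_smul_const (dualOp A) r).continuousAt

theorem dualInput_apply (A : Matrix (Fin n) (Fin n) ℝ) (B : Matrix (Fin n) (Fin m) ℝ) (T : ℝ)
    (w : Fin n → ℂ) : dualInput A B T w = (B.map (algebraMap ℝ ℂ))ᵀ *ᵥ
      ∫ r in (0 : ℝ)..T, NormedSpace.exp (r • dualOp A) w := by
  rw [← ContinuousLinearMap.intervalIntegral_apply
    ((continuous_exp_smul_dualOp A).intervalIntegrable 0 T)]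
  rfl

/-- Sampling with a nonpathological period preserves controllability. -/
theorem eq_zero_of_sampled_unreachable {B : Matrix (Fin n) (Fin m) ℝ} (hAB : Controllable A B)
    (hA : NonpathologicalPeriod A T) (hT : 0 < T) {w : Fin n → ℂ}
    (hw : ∀ k : ℕ, dualInput A B T
      (((NormedSpace.exp (T • dualOp A) : (Fin n → ℂ) →L[ℂ] (Fin n → ℂ)) :
        Module.End ℂ (Fin n → ℂ)) ^ k • w) = 0) : w = 0 := by
  set L := dualOp A with hL
  set F : Module.End ℂ (Fin n → ℂ) :=
    ((NormedSpace.exp (T • L) : (Fin n → ℂ) →L[ℂ] (Fin n → ℂ)) : Module.End ℂ (Fin n → ℂ)) with hF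
  by_contra hw0
  -- Hautus test: the unreachable functionals are invariant under `F` and so contain an eigenvector
  -- of `F`. It is also an eigenvector of the transpose of `A`, and will be seen to annihilate `B`.
  let W : Submodule ℂ (Fin n → ℂ) :=
    ⨅ k : ℕ, LinearMap.ker (dualInput A B T ∘ₗ (F ^ k : Module.End ℂ (Fin n → ℂ)))
  have hW : ∀ x, x ∈ W ↔ ∀ k : ℕ, dualInput A B T ((F ^ k) x) = 0 := fun x => by
    simp [W, Submodule.mem_iInf]
  have hWF : ∀ x ∈ W, F x ∈ W := by
    intro x hx
    rw [hW] at hx ⊢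
    intro k
    rw [← hx (k + 1), pow_succ]
    rfl
  let w' : W := ⟨w, (hW w).2 hw⟩
  have : Nontrivial W := ⟨w', 0, fun h => hw0 (congrArg Subtype.val h)⟩
  obtain ⟨l, hl⟩ := Module.End.exists_eigenvalue (F.restrict hWF)
  obtain ⟨e, he⟩ := hl.exists_hasEigenvector
  have he0 : (e : Fin n → ℂ) ≠ 0 := fun h => he.2 (Subtype.ext h)
  have hFe : NormedSpace.exp (T • L) (e : Fin n → ℂ) = l • (e : Fin n → ℂ) :=
    congrArg Subtype.val he.apply_eq_smul
  obtain ⟨z, hz, hLz⟩ := exists_eigenvalue_of_exp_smul_apply L hT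
    (fun z w hz hw => hA.exp_injOn hT (isEigenvalue_of_hasEigenvalue_dualOp A z hz)
      (isEigenvalue_of_hasEigenvalue_dualOp A w hw)) he0 hFe
  have hz := isEigenvalue_of_hasEigenvalue_dualOp A z hz
  have hexp : ∀ r : ℝ, NormedSpace.exp (r • L) (e : Fin n → ℂ) =
      Complex.exp (r * z) • (e : Fin n → ℂ) := fun r => by
    simpa using exp_smul_apply_of_pow_eq_zero L z r (e : Fin n → ℂ) 1 (by simp [hLz])
  have hB : (B.map (algebraMap ℝ ℂ))ᵀ *ᵥ (e : Fin n → ℂ) = 0 := by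
    have h := (hW _).1 e.2 0
    rw [pow_zero, Module.End.one_apply, dualInput_apply] at h
    simp_rw [← hL, hexp] at h
    rw [intervalIntegral.integral_smul_const, mulVec_smul] at h
    exact (smul_eq_zero.1 h).resolve_left (hA.integral_exp_ne_zero hT hz)
  refine he0 (eq_zero_of_controllable hAB fun k c => ?_)
  have hA' : (e : Fin n → ℂ) ᵥ* A.map (algebraMap ℝ ℂ) = z • (e : Fin n → ℂ) := by
    rw [← mulVec_transpose]; exact hLz
  have hk : ∀ k : ℕ, (e : Fin n → ℂ) ᵥ* (A.map (algebraMap ℝ ℂ)) ^ k =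
      z ^ k • (e : Fin n → ℂ) := by
    intro k
    induction k with
    | zero => simp
    | succ k ih => rw [pow_succ, ← vecMul_vecMul, ih, smul_vecMul, hA', smul_smul, pow_succ]
  have h : (e : Fin n → ℂ) ᵥ* ((A ^ k * B).map (algebraMap ℝ ℂ)) = 0 := by
    rw [Matrix.map_mul, Matrix.map_pow, ← vecMul_vecMul, hk, smul_vecMul, ← mulVec_transpose, hB,
      smul_zero]
  simpa [vecMul, dotProduct] using congrFun h c

/-- The input-state data of a persistently exciting experiment, sampled at an arbitrary time
within the periods, have full row rank. -/
theorem eq_zero_of_persistently_exciting {B : Matrix (Fin n) (Fin m) ℝ} {N : ℕ}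
    (hAB : Controllable A B) (hA : NonpathologicalPeriod A T) (hT : 0 < T)
    {μ : ℕ → Fin m → ℝ} (hμ : (blockHankel μ N (n + 1)).rank = m * (n + 1)) {x : ℝ → Fin n → ℝ}
    (hx : ∀ i < N, ∀ s ∈ Icc ((i : ℝ) * T) (((i : ℝ) + 1) * T),
      HasDerivWithinAt x (A *ᵥ x s + B *ᵥ μ i) (Icc ((i : ℝ) * T) (((i : ℝ) + 1) * T)) s)
    {t : ℝ} (ht : t ∈ Icc 0 T) {w : Fin n → ℂ} {η : Fin m → ℂ}
    (hw : ∀ i < N, w ⬝ᵥ complexify (x (t + i * T)) + η ⬝ᵥ complexify (μ i) = 0) :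
    w = 0 ∧ η = 0 := by
  have htrans : ∀ i < N, ∀ r ∈ Icc 0 T, ∀ w : Fin n → ℂ, w ⬝ᵥ complexify (x (r + i * T)) =
      NormedSpace.exp (r • dualOp A) w ⬝ᵥ complexify (x (i * T)) +
        dualInput A B r w ⬝ᵥ complexify (μ i) := by
    intro i hi r hr w
    have h := dotProduct_trajectory (hx i hi) w (s := r + i * T)
      ⟨by linarith [hr.1], by linarith [hr.2]⟩
    rw [h, add_sub_cancel_right, dualInput_apply, complexify_mulVec, mulVec_transpose,
      dotProduct_mulVec]
  -- Each relation at offset `t` is pulled back to the start of its period, at the price of adding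
  -- to `η` the dual input over `[0, t]`.
  obtain ⟨h1, h2⟩ := left_kernel_of_persistently_exciting (N := N)
    (F := ((NormedSpace.exp (T • dualOp A) : (Fin n → ℂ) →L[ℂ] (Fin n → ℂ)) :
      Module.End ℂ (Fin n → ℂ))) (b := dualInput A B T)
    (X := fun i => complexify (x (i * T))) (U := fun i => complexify (μ i))
    (fun i hi w => by
      have h := htrans i hi T ⟨hT.le, le_rfl⟩ w
      have e : (((i + 1 : ℕ) : ℝ) * T) = T + i * T := by push_cast; ring
      rw [e]; exact h)
    (fun h hh j hj => eq_zero_of_blockHankel hμ (fun i hi => hh i (by omega)) (by omega))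
    (w := NormedSpace.exp (t • dualOp A) w) (η := dualInput A B t w + η)
    (fun i hi => by rw [add_dotProduct, ← add_assoc, ← htrans i hi t ht w, hw i hi])
  have h3 := eq_zero_of_sampled_unreachable hAB hA hT h2
  have h4 : w = 0 := by
    let _ : NormedAlgebra ℚ ((Fin n → ℂ) →L[ℂ] (Fin n → ℂ)) :=
      NormedAlgebra.restrictScalars ℚ ℂ ((Fin n → ℂ) →L[ℂ] (Fin n → ℂ))
    have h5 := NormedSpace.exp_add_of_commute (Commute.neg_left (Commute.refl (t • dualOp A)))
    rw [neg_add_cancel, NormedSpace.exp_zero] at h5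
    have h6 := congrArg (fun f : (Fin n → ℂ) →L[ℂ] (Fin n → ℂ) => f w) h5
    have h7 : w = NormedSpace.exp (-(t • dualOp A)) (NormedSpace.exp (t • dualOp A) w) := h6
    rw [h7, h3, map_zero]
  refine ⟨h4, ?_⟩
  rwa [h4, map_zero, zero_add] at h1

/-- A trajectory under a piecewise constant input is differentiable on each block. -/
theorem IsTrajectory.hasDerivWithinAt {B : Matrix (Fin n) (Fin m) ℝ} {N : ℕ} (hT : 0 < T)
    {u : ℝ → Fin m → ℝ} {x : ℝ → Fin n → ℝ} (hx : IsTrajectory A B u x (N * T))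
    {μ : ℕ → Fin m → ℝ} (hu : ∀ i < N, ∀ t ∈ Ico 0 T, u (t + i * T) = μ i) :
    ∀ i < N, ∀ s ∈ Icc ((i : ℝ) * T) (((i : ℝ) + 1) * T),
      HasDerivWithinAt x (A *ᵥ x s + B *ᵥ μ i) (Icc ((i : ℝ) * T) (((i : ℝ) + 1) * T)) s := by
  intro i hi s hs
  obtain ⟨hc, hui, hxi⟩ := hx
  set a := (i : ℝ) * T with ha
  set b := ((i : ℝ) + 1) * T with hb
  have hab : a ≤ b := by rw [ha, hb]; nlinarith
  have ha0 : 0 ≤ a := by positivity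
  have hbN : b ≤ N * T := by
    have : (i : ℝ) + 1 ≤ N := by exact_mod_cast hi
    exact mul_le_mul_of_nonneg_right this hT.le
  have hsub : Icc a b ⊆ Icc 0 (N * T) := Icc_subset_Icc ha0 hbN
  -- Freezing the state outside the block makes the integrand continuous on the whole line, so the
  -- fundamental theorem also covers the end points.
  set g : ℝ → Fin n → ℝ := fun r => A *ᵥ x (projIcc a b hab r) + B *ᵥ μ i with hg
  have hgc : Continuous g := by
    have h1 : Continuous fun r => x (projIcc a b hab r) :=
      (continuousOn_iff_continuous_domRestrict.1 (hc.mono hsub)).comp continuous_projIcc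
    exact (continuous_const.matrix_mulVec h1).add continuous_const
  have hgs : ∀ r ∈ Icc a b, g r = A *ᵥ x r + B *ᵥ μ i := fun r hr => by
    simp only [hg]; rw [projIcc_of_mem hab hr]
  have hf : IntervalIntegrable (fun r => A *ᵥ x r + B *ᵥ u r) volume 0 (N * T) := by
    have h0 : 0 ≤ (N : ℝ) * T := ha0.trans (hab.trans hbN)
    have h1 : IntervalIntegrable (fun r => A *ᵥ x r) volume 0 (N * T) := by
      refine ContinuousOn.intervalIntegrable ?_
      rw [uIcc_of_le h0]
      exact (continuous_const.matrix_mulVec continuous_id :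
        Continuous fun v => A *ᵥ v).comp_continuousOn hc
    refine h1.add ?_
    have h2 := (LinearMap.toContinuousLinearMap B.mulVecLin).integrable_comp hui.1
    exact (intervalIntegrable_iff_integrableOn_Ioc_of_le h0).2 h2
  have hx' : ∀ r ∈ Icc a b, x r = x a + ∫ y in a..r, g y := by
    intro r hr
    have h1 : IntervalIntegrable (fun r => A *ᵥ x r + B *ᵥ u r) volume 0 a :=
      hf.mono_set (by rw [uIcc_of_le ha0, uIcc_of_le (ha0.trans (hab.trans hbN))]
                      exact Icc_subset_Icc_right (hab.trans hbN))
    have h2 : IntervalIntegrable (fun r => A *ᵥ x r + B *ᵥ u r) volume a r :=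
      hf.mono_set (by rw [uIcc_of_le hr.1, uIcc_of_le (ha0.trans (hab.trans hbN))]
                      exact Icc_subset_Icc ha0 (hr.2.trans hbN))
    rw [hxi r (hsub hr), hxi a (hsub (left_mem_Icc.2 hab)), add_assoc,
      ← intervalIntegral.integral_add_adjacent_intervals h1 h2]
    congr 2
    -- The value of `u` at the right end of the block is not `μ i` in general, hence the passage to
    -- open intervals.
    rw [intervalIntegral.integral_of_le hr.1, intervalIntegral.integral_of_le hr.1,
      integral_Ioc_eq_integral_Ioo, integral_Ioc_eq_integral_Ioo]
    refine setIntegral_congr_fun measurableSet_Ioo fun y hy => ?_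
    have h3 := hu i hi (y - i * T)
      ⟨by linarith [hy.1], by have := hy.2.trans_le hr.2; rw [hb] at this; linarith⟩
    rw [sub_add_cancel] at h3
    simp only [h3]
    rw [hgs y ⟨hy.1.le, hy.2.le.trans hr.2⟩]
  have hd : HasDerivAt (fun r => x a + ∫ y in a..r, g y) (g s) s :=
    (intervalIntegral.integral_hasDerivAt_right (hgc.intervalIntegrable a s)
      (hgc.stronglyMeasurableAtFilter _ _) hgc.continuousAt).const_add _
  rw [← hgs s hs]
  exact hd.hasDerivWithinAt.congr hx' (hx' s hs)

end Sampling

/-! ### Quadratic forms along linear flows -/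

section Lyapunov

variable {n m : ℕ}

theorem hasDerivAt_dotProduct {d : ℕ} {f g : ℝ → Fin d → ℝ} {f' g' : Fin d → ℝ} {t : ℝ}
    (hf : HasDerivAt f f' t) (hg : HasDerivAt g g' t) :
    HasDerivAt (fun r => f r ⬝ᵥ g r) (f' ⬝ᵥ g t + f t ⬝ᵥ g') t := by
  rw [hasDerivAt_pi] at hf hg
  have := HasDerivAt.fun_sum (u := Finset.univ) fun i _ => (hf i).mul (hg i)
  simpa [dotProduct, Finset.sum_add_distrib] using this

theorem hasDerivAt_mulVec {d e : ℕ} (M : Matrix (Fin e) (Fin d) ℝ) {f : ℝ → Fin d → ℝ}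
    {f' : Fin d → ℝ} {t : ℝ} (hf : HasDerivAt f f' t) :
    HasDerivAt (fun r => M *ᵥ f r) (M *ᵥ f') t :=
  (LinearMap.toContinuousLinearMap M.mulVecLin).hasFDerivAt.comp_hasDerivAt t hf

/-- The flow is the matrix exponential. The last clause, read off its series, makes the state cost
vanish along free motions from unobservable states. -/
theorem exists_linear_flow (F : Matrix (Fin n) (Fin n) ℝ) (v : Fin n → ℝ) :
    ∃ x : ℝ → Fin n → ℝ, x 0 = v ∧ (∀ t, HasDerivAt x (F *ᵥ x t) t) ∧
      ∀ Q : Matrix (Fin n) (Fin n) ℝ, (∀ k : ℕ, Q *ᵥ ((F ^ k) *ᵥ v) = 0) →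
        ∀ t, Q *ᵥ x t = 0 := by
  set L : (Fin n → ℝ) →L[ℝ] (Fin n → ℝ) := LinearMap.toContinuousLinearMap F.mulVecLin with hL
  have hLv : ∀ w, L w = F *ᵥ w := fun w => rfl
  refine ⟨fun t => NormedSpace.exp (t • L) v, ?_, fun t => ?_, fun Q hQ t => ?_⟩
  · simp
  · exact (ContinuousLinearMap.apply ℝ (Fin n → ℝ) v).hasFDerivAt.comp_hasDerivAt t
      (hasDerivAt_exp_smul_const' L t)
  · have h := NormedSpace.exp_series_hasSum_exp' (𝕂 := ℝ) (t • L)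
    have h2 := (LinearMap.toContinuousLinearMap Q.mulVecLin).hasSum
      ((ContinuousLinearMap.apply ℝ (Fin n → ℝ) v).hasSum h)
    have hpow : ∀ k : ℕ, (L ^ k) v = (F ^ k) *ᵥ v := by
      intro k
      induction k with
      | zero => simp
      | succ k ih =>
        rw [pow_succ', pow_succ', ← mulVec_mulVec, ← ih]; rfl
    refine h2.unique ?_
    convert hasSum_zero using 2 with k
    have e : ((k.factorial : ℝ)⁻¹ • (t • L) ^ k) v = ((k.factorial : ℝ)⁻¹ * t ^ k) •
        ((F ^ k) *ᵥ v) := by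
      rw [smul_pow, smul_smul, ← hpow]; rfl
    show Q *ᵥ (((k.factorial : ℝ)⁻¹ • (t • L) ^ k) v) = 0
    rw [e, mulVec_smul, hQ, smul_zero]

theorem hasDerivAt_bilin {F P : Matrix (Fin n) (Fin n) ℝ} {x y : ℝ → Fin n → ℝ}
    (hx : ∀ t, HasDerivAt x (F *ᵥ x t) t) (hy : ∀ t, HasDerivAt y (F *ᵥ y t) t) (t : ℝ) :
    HasDerivAt (fun t => x t ⬝ᵥ (P *ᵥ y t)) (x t ⬝ᵥ ((P * F + Fᵀ * P) *ᵥ y t)) t := by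
  refine (hasDerivAt_dotProduct (hx t) (hasDerivAt_mulVec P (hy t))).congr_deriv ?_
  rw [add_mulVec, dotProduct_add, ← mulVec_mulVec, ← mulVec_mulVec, dotProduct_mulVec _ Fᵀ,
    vecMul_transpose, add_comm]

theorem tendsto_bilin {P : Matrix (Fin n) (Fin n) ℝ} {x y : ℝ → Fin n → ℝ}
    (hx : Tendsto x atTop (𝓝 0)) (hy : Tendsto y atTop (𝓝 0)) :
    Tendsto (fun t => x t ⬝ᵥ (P *ᵥ y t)) atTop (𝓝 0) := by
  have hc : Continuous fun p : (Fin n → ℝ) × (Fin n → ℝ) => p.1 ⬝ᵥ (P *ᵥ p.2) :=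
    continuous_fst.dotProduct (continuous_const.matrix_mulVec continuous_snd)
  have h := (hc.tendsto (0, 0)).comp (hx.prodMk_nhds hy)
  rw [zero_dotProduct] at h
  exact h

theorem ext_dotProduct_mulVec {d e : ℕ} {M N : Matrix (Fin d) (Fin e) ℝ}
    (h : ∀ v w, v ⬝ᵥ (M *ᵥ w) = v ⬝ᵥ (N *ᵥ w)) : M = N := by
  ext i j
  simpa using h (Pi.single i 1) (Pi.single j 1)

theorem posSemidef_iff_real {M : Matrix (Fin n) (Fin n) ℝ} :
    M.PosSemidef ↔ Mᵀ = M ∧ ∀ v, 0 ≤ v ⬝ᵥ (M *ᵥ v) := by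
  simp [posSemidef_iff_dotProduct_mulVec, IsHermitian]

theorem posDef_iff_real {M : Matrix (Fin n) (Fin n) ℝ} :
    M.PosDef ↔ Mᵀ = M ∧ ∀ v, v ≠ 0 → 0 < v ⬝ᵥ (M *ᵥ v) := by
  simp [posDef_iff_dotProduct_mulVec, IsHermitian]

/-- Solvability of the Lyapunov equation. -/
theorem exists_lyapunov {F : Matrix (Fin n) (Fin n) ℝ} (hF : ∀ z, IsEigenvalue F z → z.re < 0)
    {M : Matrix (Fin n) (Fin n) ℝ} (hM : M.PosSemidef) :
    ∃ P : Matrix (Fin n) (Fin n) ℝ, P.PosSemidef ∧ P * F + Fᵀ * P = -M := by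
  let Φ : Matrix (Fin n) (Fin n) ℝ →ₗ[ℝ] Matrix (Fin n) (Fin n) ℝ :=
    LinearMap.mulRight ℝ F + LinearMap.mulLeft ℝ Fᵀ
  have hΦ : ∀ X, Φ X = X * F + Fᵀ * X := fun X => rfl
  -- A solution of the homogeneous equation is constant along pairs of flows, which decay to zero.
  have hinj : Function.Injective Φ := by
    rw [← LinearMap.ker_eq_bot]
    refine LinearMap.ker_eq_bot'.2 fun X hX => ext_dotProduct_mulVec fun v w => ?_
    obtain ⟨x, rfl, hx, -⟩ := exists_linear_flow F v
    obtain ⟨y, rfl, hy, -⟩ := exists_linear_flow F w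
    have hd : ∀ t, HasDerivAt (fun t => x t ⬝ᵥ (X *ᵥ y t)) 0 t := fun t => by
      have := hasDerivAt_bilin (P := X) hx hy t
      rwa [← hΦ, hX, zero_mulVec, dotProduct_zero] at this
    have hc := is_const_of_deriv_eq_zero (fun t => (hd t).differentiableAt) fun t => (hd t).deriv
    have hl := tendsto_bilin (P := X) (tendsto_zero_of_eigenvalues_re_neg hF hx)
      (tendsto_zero_of_eigenvalues_re_neg hF hy)
    have h0 : Tendsto (fun t => x t ⬝ᵥ (X *ᵥ y t)) atTop (𝓝 (x 0 ⬝ᵥ (X *ᵥ y 0))) :=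
      tendsto_const_nhds.congr fun t => hc 0 t
    rw [tendsto_nhds_unique h0 hl, zero_mulVec, dotProduct_zero]
  obtain ⟨P, hP⟩ := LinearMap.injective_iff_surjective.1 hinj (-M)
  have hMs := (posSemidef_iff_real.1 hM).1
  refine ⟨P, posSemidef_iff_real.2 ⟨hinj ?_, fun v => ?_⟩, hP⟩
  · rw [hP, hΦ]
    have := congrArg transpose hP
    rw [hΦ] at this
    simp only [transpose_add, transpose_mul, transpose_transpose, transpose_neg, hMs] at this
    rw [← this, add_comm]
  · obtain ⟨x, rfl, hx, -⟩ := exists_linear_flow F v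
    have hd : ∀ t, HasDerivAt (fun t => x t ⬝ᵥ (P *ᵥ x t)) (-(x t ⬝ᵥ (M *ᵥ x t))) t := fun t => by
      have := hasDerivAt_bilin (P := P) hx hx t
      rwa [← hΦ, hP, neg_mulVec, dotProduct_neg] at this
    have hanti : Antitone fun t => x t ⬝ᵥ (P *ᵥ x t) :=
      antitone_of_deriv_nonpos (fun t => (hd t).differentiableAt) fun t => by
        rw [(hd t).deriv, neg_nonpos]; exact (posSemidef_iff_real.1 hM).2 _
    have hx0 := tendsto_zero_of_eigenvalues_re_neg hF hx
    exact hanti.le_of_tendsto (tendsto_bilin hx0 hx0) 0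

/-- The value of the Lyapunov function bounds the cost from below. -/
theorem le_lintegral_of_lyapunov {F P W : Matrix (Fin n) (Fin n) ℝ} (hW : W.PosSemidef)
    (hP : P * F + Fᵀ * P = -W) {x : ℝ → Fin n → ℝ} (hx : ∀ t, HasDerivAt x (F *ᵥ x t) t)
    (hx0 : Tendsto x atTop (𝓝 0)) :
    ENNReal.ofReal (x 0 ⬝ᵥ (P *ᵥ x 0)) ≤
      ∫⁻ t in Ici (0 : ℝ), ENNReal.ofReal (x t ⬝ᵥ (W *ᵥ x t)) := by
  have hxc : Continuous x := continuous_iff_continuousAt.2 fun t => (hx t).continuousAt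
  have hg : Continuous fun t => x t ⬝ᵥ (W *ᵥ x t) :=
    hxc.dotProduct (continuous_const.matrix_mulVec hxc)
  have h1 : Tendsto (fun b => ENNReal.ofReal (x 0 ⬝ᵥ (P *ᵥ x 0) - x b ⬝ᵥ (P *ᵥ x b))) atTop
      (𝓝 (ENNReal.ofReal (x 0 ⬝ᵥ (P *ᵥ x 0)))) := by
    have := (tendsto_const_nhds (x := x 0 ⬝ᵥ (P *ᵥ x 0))).sub (tendsto_bilin (P := P) hx0 hx0)
    rw [sub_zero] at this
    exact ENNReal.tendsto_ofReal this
  refine le_of_tendsto h1 ?_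
  filter_upwards [eventually_ge_atTop 0] with b hb
  have h2 : ∫ t in (0 : ℝ)..b, x t ⬝ᵥ (W *ᵥ x t) = x 0 ⬝ᵥ (P *ᵥ x 0) - x b ⬝ᵥ (P *ᵥ x b) := by
    have h3 := intervalIntegral.integral_eq_sub_of_hasDerivAt (a := 0) (b := b)
      (f := fun t => -(x t ⬝ᵥ (P *ᵥ x t))) (f' := fun t => x t ⬝ᵥ (W *ᵥ x t))
      (fun t _ => by
        have := (hasDerivAt_bilin (P := P) hx hx t).neg
        rw [hP, neg_mulVec, dotProduct_neg, neg_neg] at this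
        exact this) (hg.intervalIntegrable _ _)
    rw [h3]; ring
  rw [← h2, intervalIntegral.integral_of_le hb, ofReal_integral_eq_lintegral_ofReal
    hg.integrableOn_Ioc (ae_of_all _ fun t => (posSemidef_iff_real.1 hW).2 _)]
  exact lintegral_mono_set (Ioc_subset_Icc_self.trans Icc_subset_Ici_self)

/-- The value of the Lyapunov function, less the excess dissipation, bounds the cost from above. -/
theorem lintegral_le_of_lyapunov {F P W Z : Matrix (Fin n) (Fin n) ℝ} (hPs : P.PosSemidef)
    (hW : W.PosSemidef) (hZ : Z.PosSemidef)
    (hP : P * F + Fᵀ * P = -W - Z) {x : ℝ → Fin n → ℝ} (hx : ∀ t, HasDerivAt x (F *ᵥ x t) t) :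
    0 ≤ x 0 ⬝ᵥ (P *ᵥ x 0) - ∫ t in (0 : ℝ)..1, x t ⬝ᵥ (Z *ᵥ x t) ∧
    ∫⁻ t in Ici (0 : ℝ), ENNReal.ofReal (x t ⬝ᵥ (W *ᵥ x t)) ≤
      ENNReal.ofReal (x 0 ⬝ᵥ (P *ᵥ x 0) - ∫ t in (0 : ℝ)..1, x t ⬝ᵥ (Z *ᵥ x t)) := by
  have hxc : Continuous x := continuous_iff_continuousAt.2 fun t => (hx t).continuousAt
  have hq : ∀ M : Matrix (Fin n) (Fin n) ℝ, Continuous fun t => x t ⬝ᵥ (M *ᵥ x t) := fun M =>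
    hxc.dotProduct (continuous_const.matrix_mulVec hxc)
  have hWn : ∀ t, 0 ≤ x t ⬝ᵥ (W *ᵥ x t) := fun t => (posSemidef_iff_real.1 hW).2 _
  have hZn : ∀ t, 0 ≤ x t ⬝ᵥ (Z *ᵥ x t) := fun t => (posSemidef_iff_real.1 hZ).2 _
  -- The excess `Z` is counted on `[0, 1]` only, which suffices for a strict gain. Semidefiniteness
  -- of `P` disposes of the terminal term, so the flow need not decay.
  have hI : ∀ b, 1 ≤ b → ∫ t in (0 : ℝ)..b, x t ⬝ᵥ (W *ᵥ x t) ≤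
      x 0 ⬝ᵥ (P *ᵥ x 0) - ∫ t in (0 : ℝ)..1, x t ⬝ᵥ (Z *ᵥ x t) := by
    intro b hb
    have h3 := intervalIntegral.integral_eq_sub_of_hasDerivAt (a := 0) (b := b)
      (f := fun t => -(x t ⬝ᵥ (P *ᵥ x t)))
      (f' := fun t => x t ⬝ᵥ (W *ᵥ x t) + x t ⬝ᵥ (Z *ᵥ x t))
      (fun t _ => by
        have := (hasDerivAt_bilin (P := P) hx hx t).neg
        rw [hP, sub_mulVec, dotProduct_sub, neg_mulVec, dotProduct_neg, neg_sub_left, neg_neg,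
          add_comm] at this
        exact this) (((hq W).add (hq Z)).intervalIntegrable _ _)
    rw [intervalIntegral.integral_add ((hq W).intervalIntegrable _ _)
      ((hq Z).intervalIntegrable _ _)] at h3
    have h4 := intervalIntegral.integral_add_adjacent_intervals
      ((hq Z).intervalIntegrable (μ := volume) 0 1) ((hq Z).intervalIntegrable 1 b)
    have h5 := intervalIntegral.integral_nonneg hb (μ := volume) fun t _ => hZn t
    have h6 := (posSemidef_iff_real.1 hPs).2 (x b)
    linarith
  refine ⟨(intervalIntegral.integral_nonneg zero_le_one fun t _ => hWn t).trans (hI 1 le_rfl), ?_⟩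
  have hlim := (aecover_Iic (μ := volume.restrict (Ici (0 : ℝ)))
    (tendsto_id : Tendsto (fun b : ℝ => b) atTop atTop)).lintegral_tendsto_of_countably_generated
    (f := fun t => ENNReal.ofReal (x t ⬝ᵥ (W *ᵥ x t)))
    (ENNReal.measurable_ofReal.comp (hq W).measurable).aemeasurable
  refine le_of_tendsto hlim ?_
  filter_upwards [eventually_ge_atTop 1] with b hb
  rw [id_eq, Measure.restrict_restrict measurableSet_Iic, inter_comm, Ici_inter_Iic,
    setLIntegral_congr Ioc_ae_eq_Icc.symm, ← ofReal_integral_eq_lintegral_ofReal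
      (hq W).integrableOn_Ioc (ae_of_all _ hWn),
    ← intervalIntegral.integral_of_le (zero_le_one.trans hb)]
  exact ENNReal.ofReal_le_ofReal (hI b hb)

theorem isTrajectory_of_hasDerivAt {A : Matrix (Fin n) (Fin n) ℝ} {B : Matrix (Fin n) (Fin m) ℝ}
    {K : Matrix (Fin m) (Fin n) ℝ} {x : ℝ → Fin n → ℝ}
    (hx : ∀ t, HasDerivAt x ((A - B * K) *ᵥ x t) t) (b : ℝ) :
    IsTrajectory A B (fun t => -(K *ᵥ x t)) x b := by
  have hxc : Continuous x := continuous_iff_continuousAt.2 fun t => (hx t).continuousAt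
  have hK : Continuous fun t => -(K *ᵥ x t) := (continuous_const.matrix_mulVec hxc).neg
  refine ⟨hxc.continuousOn, hK.intervalIntegrable _ _, fun t _ => ?_⟩
  have e : ∀ s, A *ᵥ x s + B *ᵥ (-(K *ᵥ x s)) = (A - B * K) *ᵥ x s := fun s => by
    rw [mulVec_neg, mulVec_mulVec, sub_mulVec, sub_eq_add_neg]
  simp_rw [e]
  rw [intervalIntegral.integral_eq_sub_of_hasDerivAt (fun t _ => hx t)
    ((continuous_const.matrix_mulVec hxc).intervalIntegrable _ _)]
  simp

theorem lqrCost_feedback (Q : Matrix (Fin n) (Fin n) ℝ) (R : Matrix (Fin m) (Fin m) ℝ)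
    (K : Matrix (Fin m) (Fin n) ℝ) (x : ℝ → Fin n → ℝ) :
    lqrCost Q R x (fun t => -(K *ᵥ x t)) =
      ∫⁻ t in Ici (0 : ℝ), ENNReal.ofReal (x t ⬝ᵥ ((Q + Kᵀ * R * K) *ᵥ x t)) := by
  unfold lqrCost
  congr 1 with t
  congr 1
  rw [mulVec_neg, neg_dotProduct, dotProduct_neg, neg_neg, add_mulVec, dotProduct_add, Matrix.mul_assoc,
    ← mulVec_mulVec, dotProduct_mulVec _ Kᵀ, vecMul_transpose, ← mulVec_mulVec]

theorem transpose_mul_mul_posSemidef {d e : ℕ} {R : Matrix (Fin d) (Fin d) ℝ} (hR : R.PosSemidef)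
    (K : Matrix (Fin d) (Fin e) ℝ) : (Kᵀ * R * K).PosSemidef := by
  have := hR.conjTranspose_mul_mul_same K
  rwa [conjTranspose_eq_transpose_of_trivial] at this

/-- An optimal stabilizing gain satisfies the stationarity condition. -/
theorem IsLQROptimal.mul_eq {A : Matrix (Fin n) (Fin n) ℝ} {B : Matrix (Fin n) (Fin m) ℝ}
    {K : Matrix (Fin m) (Fin n) ℝ} (hK : Stabilizing A B K) {Q : Matrix (Fin n) (Fin n) ℝ}
    {R : Matrix (Fin m) (Fin m) ℝ} (hQ : Q.PosSemidef) (hR : R.PosDef)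
    (hopt : IsLQROptimal A B Q R K) {P : Matrix (Fin n) (Fin n) ℝ} (hP : P.PosSemidef)
    (hlyap : P * (A - B * K) + (A - B * K)ᵀ * P = -(Q + Kᵀ * R * K)) : R * K = Bᵀ * P := by
  have hRt := (posDef_iff_real.1 hR).1
  have hPt := (posSemidef_iff_real.1 hP).1
  have hRu : IsUnit R.det := (isUnit_iff_isUnit_det R).1 hR.isUnit
  -- Policy improvement: with this gain, `P` satisfies a Lyapunov equation with the extra
  -- dissipation `(K' - K)ᵀ * R * (K' - K)`. Stability under `K'` is not required.
  set K' := R⁻¹ * (Bᵀ * P) with hK'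
  have hRK' : R * K' = Bᵀ * P := mul_nonsing_inv_cancel_left _ _ hRu
  have hRK't : K'ᵀ * R = P * B := by
    have := congrArg transpose hRK'
    simpa [transpose_mul, hRt, hPt] using this
  have hlyap' : P * (A - B * K') + (A - B * K')ᵀ * P =
      -(Q + K'ᵀ * R * K') - (K' - K)ᵀ * R * (K' - K) := by
    have e1 : P * (A - B * K') + (A - B * K')ᵀ * P = (P * (A - B * K) + (A - B * K)ᵀ * P)
        - P * B * (K' - K) - (K' - K)ᵀ * (Bᵀ * P) := by
      simp only [transpose_sub, transpose_mul, Matrix.mul_sub, Matrix.sub_mul, Matrix.mul_assoc]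
      abel
    rw [e1, hlyap, ← hRK't, ← hRK']
    simp only [transpose_sub, Matrix.mul_sub, Matrix.sub_mul, Matrix.mul_assoc]
    abel
  have hW : ∀ K : Matrix (Fin m) (Fin n) ℝ, (Q + Kᵀ * R * K).PosSemidef := fun K =>
    hQ.add (transpose_mul_mul_posSemidef hR.posSemidef K)
  have hZ := transpose_mul_mul_posSemidef hR.posSemidef (K' - K)
  suffices h : K' - K = 0 by rw [← hRK', sub_eq_zero.1 h]
  refine ext_dotProduct_mulVec fun v w => ?_
  suffices h : (K' - K) *ᵥ w = 0 by rw [h, zero_mulVec]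
  obtain ⟨x, hx0, hx, -⟩ := exists_linear_flow (A - B * K) w
  obtain ⟨y, hy0, hy, -⟩ := exists_linear_flow (A - B * K') w
  have h1 := le_lintegral_of_lyapunov (hW K) hlyap hx
    (tendsto_zero_of_eigenvalues_re_neg hK hx)
  obtain ⟨hpos, h2⟩ := lintegral_le_of_lyapunov hP (hW K') hZ hlyap' hy
  have h3 := hopt x (fun b _ => isTrajectory_of_hasDerivAt hx b) _ y
    (fun b _ => isTrajectory_of_hasDerivAt hy b) (hy0.trans hx0.symm)
  rw [lqrCost_feedback, lqrCost_feedback] at h3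
  have h4 := h1.trans (h3.trans h2)
  rw [hx0, ← hy0] at h4
  have hyc : Continuous y := continuous_iff_continuousAt.2 fun t => (hy t).continuousAt
  have hq : ∀ M : Matrix (Fin n) (Fin n) ℝ, Continuous fun t => y t ⬝ᵥ (M *ᵥ y t) := fun M =>
    hyc.dotProduct (continuous_const.matrix_mulVec hyc)
  set Z := (K' - K)ᵀ * R * (K' - K) with hZdef
  have h5 := (ENNReal.ofReal_le_ofReal_iff hpos).1 h4
  by_contra hne
  have h6 : 0 < y 0 ⬝ᵥ (Z *ᵥ y 0) := by
    rw [hy0, hZdef, Matrix.mul_assoc, ← mulVec_mulVec, dotProduct_mulVec _ (K' - K)ᵀ,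
      vecMul_transpose, ← mulVec_mulVec]
    exact (posDef_iff_real.1 hR).2 _ hne
  have h7 := intervalIntegral.integral_pos zero_lt_one (hq Z).continuousOn
    (fun t _ => (posSemidef_iff_real.1 hZ).2 (y t)) ⟨0, by simp, h6⟩
  linarith

/-- Under an optimal stabilizing gain, states that are unobservable through the state weight are
not actuated. -/
theorem IsLQROptimal.mulVec_eq_zero {A : Matrix (Fin n) (Fin n) ℝ} {B : Matrix (Fin n) (Fin m) ℝ}
    {K : Matrix (Fin m) (Fin n) ℝ} (hK : Stabilizing A B K) {Q : Matrix (Fin n) (Fin n) ℝ}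
    {R : Matrix (Fin m) (Fin m) ℝ} (hQ : Q.PosSemidef) (hR : R.PosDef)
    (hopt : IsLQROptimal A B Q R K) {z : Fin n → ℝ} (hz : ∀ k : ℕ, Q *ᵥ ((A ^ k) *ᵥ z) = 0) :
    K *ᵥ z = 0 := by
  obtain ⟨P, hP, hlyap⟩ := exists_lyapunov hK
    (hQ.add (transpose_mul_mul_posSemidef hR.posSemidef K))
  have hRK := hopt.mul_eq hK hQ hR hP hlyap
  obtain ⟨x, hx0, hx, -⟩ := exists_linear_flow (A - B * K) z
  obtain ⟨y, hy0, hy, hyQ⟩ := exists_linear_flow A z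
  have h1 := le_lintegral_of_lyapunov (hQ.add (transpose_mul_mul_posSemidef hR.posSemidef K))
    hlyap hx (tendsto_zero_of_eigenvalues_re_neg hK hx)
  -- The competitor is the zero input, whose cost from `z` is zero. Hence `P *ᵥ z = 0`, and
  -- stationarity gives `K *ᵥ z = 0`.
  have h3 := hopt x (fun b _ => isTrajectory_of_hasDerivAt hx b) _ y
    (fun b _ => isTrajectory_of_hasDerivAt (B := B) (K := 0) (by simpa using hy) b)
    (hy0.trans hx0.symm)
  rw [lqrCost_feedback, lqrCost_feedback] at h3
  have h4 := h1.trans h3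
  simp [hyQ Q hz, hx0] at h4
  have h5 : z ⬝ᵥ (P *ᵥ z) = 0 := le_antisymm h4 ((posSemidef_iff_real.1 hP).2 z)
  have h6 : P *ᵥ z = 0 := by
    rw [← hP.dotProduct_mulVec_zero_iff]; simpa using h5
  have h7 : R *ᵥ (K *ᵥ z) = 0 := by rw [mulVec_mulVec, hRK, ← mulVec_mulVec, h6, mulVec_zero]
  by_contra h8
  have := (posDef_iff_real.1 hR).2 _ h8
  rw [h7, dotProduct_zero] at this
  exact this.false

end Lyapunov

/-! ### A strict linear matrix inequality -/

section LMI

variable {n m : ℕ}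

theorem abs_dotProduct_mulVec_le (D : Matrix (Fin n) (Fin n) ℝ) (v : Fin n → ℝ) :
    |v ⬝ᵥ (D *ᵥ v)| ≤ (∑ i, ∑ j, |D i j|) * (v ⬝ᵥ v) := by
  have hv : ∀ i, v i * v i ≤ v ⬝ᵥ v := fun i =>
    Finset.single_le_sum (f := fun i => v i * v i) (fun i _ => mul_self_nonneg _)
      (Finset.mem_univ i)
  have hvv : ∀ i j, |v i| * |v j| ≤ v ⬝ᵥ v := fun i j => by
    nlinarith [hv i, hv j, sq_nonneg (|v i| - |v j|), abs_mul_abs_self (v i),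
      abs_mul_abs_self (v j)]
  have e : v ⬝ᵥ (D *ᵥ v) = ∑ i, ∑ j, v i * (D i j * v j) := by
    simp only [dotProduct, mulVec, Finset.mul_sum]
  rw [e, Finset.sum_mul]
  refine (Finset.abs_sum_le_sum_abs _ _).trans (Finset.sum_le_sum fun i _ => ?_)
  rw [Finset.sum_mul]
  refine (Finset.abs_sum_le_sum_abs _ _).trans (Finset.sum_le_sum fun j _ => ?_)
  rw [abs_mul, abs_mul, mul_left_comm]
  exact mul_le_mul_of_nonneg_left (hvv i j) (abs_nonneg _)

/-- The matrices whose quadratic form is uniformly positive. -/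
def coerciveMatrices (n : ℕ) : Set (Matrix (Fin n) (Fin n) ℝ) :=
  {M | ∃ c > 0, ∀ v : Fin n → ℝ, c * (v ⬝ᵥ v) ≤ v ⬝ᵥ (M *ᵥ v)}

theorem dotProduct_self_nonneg_real (v : Fin n → ℝ) : 0 ≤ v ⬝ᵥ v :=
  dotProduct_star_self_nonneg v

theorem dotProduct_self_pos {v : Fin n → ℝ} (hv : v ≠ 0) : 0 < v ⬝ᵥ v :=
  (dotProduct_self_nonneg_real v).lt_of_ne fun h => hv (dotProduct_self_eq_zero.1 h.symm)

theorem posDef_of_mem_coerciveMatrices {M : Matrix (Fin n) (Fin n) ℝ}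
    (hM : M ∈ coerciveMatrices n) (hs : Mᵀ = M) : M.PosDef := by
  obtain ⟨c, hc, h⟩ := hM
  exact posDef_iff_real.2 ⟨hs, fun v hv => (mul_pos hc (dotProduct_self_pos hv)).trans_le (h v)⟩

/-- Half of the coercivity constant absorbs a small perturbation. Symmetry is not imposed, so the
set is open among all matrices, as the separation theorem requires. -/
theorem isOpen_coerciveMatrices : IsOpen (coerciveMatrices n) := by
  rw [isOpen_iff_mem_nhds]
  rintro M ⟨c, hc, h⟩
  have hcont : Continuous fun N : Matrix (Fin n) (Fin n) ℝ => ∑ i, ∑ j, |(N - M) i j| := by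
    fun_prop
  have h0 : (fun N : Matrix (Fin n) (Fin n) ℝ => ∑ i, ∑ j, |(N - M) i j|) M < c / 2 := by
    simp [hc]
  filter_upwards [hcont.continuousAt.eventually_lt continuousAt_const h0] with N hN
  refine ⟨c / 2, half_pos hc, fun v => ?_⟩
  have h1 := abs_dotProduct_mulVec_le (N - M) v
  have h2 := mul_le_mul_of_nonneg_right hN.le (dotProduct_self_nonneg_real v)
  have h3 := (abs_le.1 (h1.trans h2)).1
  rw [sub_mulVec, dotProduct_sub] at h3
  linarith [h v]

theorem convex_coerciveMatrices : Convex ℝ (coerciveMatrices n) := by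
  rintro M ⟨c, hc, h⟩ N ⟨d, hd, h'⟩ a b ha hb hab
  refine ⟨min c d, lt_min hc hd, fun v => ?_⟩
  rw [add_mulVec, smul_mulVec, smul_mulVec, dotProduct_add, dotProduct_smul, dotProduct_smul,
    smul_eq_mul, smul_eq_mul]
  have h1 := (mul_le_mul_of_nonneg_right (min_le_left c d) (dotProduct_self_nonneg_real v)).trans (h v)
  have h2 := (mul_le_mul_of_nonneg_right (min_le_right c d) (dotProduct_self_nonneg_real v)).trans (h' v)
  calc min c d * (v ⬝ᵥ v) = a * (min c d * (v ⬝ᵥ v)) + b * (min c d * (v ⬝ᵥ v)) := by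
        rw [← add_mul, hab, one_mul]
    _ ≤ _ := add_le_add (mul_le_mul_of_nonneg_left h1 ha) (mul_le_mul_of_nonneg_left h2 hb)

/-- On symmetric matrices, every linear functional is given by the trace against a symmetric
matrix. -/
theorem exists_symm_trace_eq (f : Matrix (Fin n) (Fin n) ℝ →ₗ[ℝ] ℝ) :
    ∃ Z : Matrix (Fin n) (Fin n) ℝ, Zᵀ = Z ∧ ∀ M, Mᵀ = M → f M = (Z * M).trace := by
  let Y : Matrix (Fin n) (Fin n) ℝ := of fun i j => f (single j i 1)
  have hY : ∀ M, f M = (Y * M).trace := by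
    intro M
    conv_lhs => rw [matrix_eq_sum_single M]
    have : ∀ i j, single i j (M i j) = M i j • single i j (1 : ℝ) := fun i j => by
      rw [smul_single, smul_eq_mul, mul_one]
    simp_rw [this, map_sum, map_smul, smul_eq_mul, trace, diag, mul_apply]
    rw [Finset.sum_comm]
    exact Finset.sum_congr rfl fun i _ => Finset.sum_congr rfl fun j _ => mul_comm _ _
  refine ⟨(1 / 2 : ℝ) • (Y + Yᵀ), ?_, fun M hM => ?_⟩
  · rw [transpose_smul, transpose_add, transpose_transpose, add_comm]
  · have h : (Yᵀ * M).trace = (Y * M).trace := by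
      rw [← trace_transpose, transpose_mul, transpose_transpose, hM, trace_mul_comm]
    rw [hY, smul_mul_assoc, trace_smul, add_mul, trace_add, h, smul_eq_mul]
    ring

theorem trace_mul_vecMulVec (Z : Matrix (Fin n) (Fin n) ℝ) (v w : Fin n → ℝ) :
    (Z * vecMulVec v w).trace = w ⬝ᵥ (Z *ᵥ v) := by
  rw [mul_vecMulVec, trace_vecMulVec, dotProduct_comm]

-- Write `Q = Cᵀ * C`: the semidefinite matrix `C * Z * Cᵀ` has trace zero and so vanishes, which
-- forces `Z * Cᵀ = 0`.
open scoped MatrixOrder in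
theorem mul_eq_zero_of_trace_mul_eq_zero {Z Q : Matrix (Fin n) (Fin n) ℝ} (hZ : Z.PosSemidef)
    (hQ : Q.PosSemidef) (h : (Z * Q).trace = 0) : Z * Q = 0 := by
  obtain ⟨C, rfl⟩ := CStarAlgebra.nonneg_iff_eq_star_mul_self.1 hQ.nonneg
  rw [star_eq_conjTranspose, conjTranspose_eq_transpose_of_trivial] at *
  have h1 : (C * Z * Cᵀ).PosSemidef := by
    simpa [conjTranspose_eq_transpose_of_trivial] using hZ.mul_mul_conjTranspose_same C
  have h2 : C * Z * Cᵀ = 0 := by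
    rw [← h1.trace_eq_zero_iff, ← h, Matrix.mul_assoc, trace_mul_comm C, Matrix.mul_assoc]
  have h3 : Z * Cᵀ = 0 := by
    refine ext_dotProduct_mulVec fun v w => ?_
    have h4 : (Cᵀ *ᵥ w) ⬝ᵥ (Z *ᵥ (Cᵀ *ᵥ w)) = 0 := by
      rw [mulVec_transpose C w, ← dotProduct_mulVec, ← mulVec_transpose C w, mulVec_mulVec,
        mulVec_mulVec, h2, zero_mulVec, dotProduct_zero]
    have h5 : Z *ᵥ (Cᵀ *ᵥ w) = 0 := by
      rw [← hZ.dotProduct_mulVec_zero_iff]; simpa using h4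
    rw [← mulVec_mulVec, h5, zero_mulVec]
  rw [← Matrix.mul_assoc, h3, Matrix.zero_mul]

/-- If no `P₁` worked, separation would give a nonzero semidefinite `Z` with `Z * Q = 0` and `A * Z
+ Z * Aᵀ` semidefinite. Its range is `A`-invariant and unobservable, so `K * Z = 0`; on it `A`
agrees with the stable `A - B * K`, and a Lyapunov function gives a contradiction. -/
theorem exists_strict_lmi {A : Matrix (Fin n) (Fin n) ℝ} {B : Matrix (Fin n) (Fin m) ℝ}
    {K : Matrix (Fin m) (Fin n) ℝ} (hK : Stabilizing A B K) {Q : Matrix (Fin n) (Fin n) ℝ}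
    (hQ : Q.PosSemidef)
    (hunobs : ∀ z : Fin n → ℝ, (∀ k : ℕ, Q *ᵥ ((A ^ k) *ᵥ z) = 0) → K *ᵥ z = 0) :
    ∃ P₁ : Matrix (Fin n) (Fin n) ℝ, P₁.PosDef ∧ (Q - P₁ * A - Aᵀ * P₁).PosDef := by
  have hQt := (posSemidef_iff_real.1 hQ).1
  -- The free multiple `s` of `Q` turns the candidates into a cone, so that the separating
  -- functional has a sign on it.
  let C : Set (Matrix (Fin n) (Fin n) ℝ) :=
    {M | ∃ s : ℝ, 0 ≤ s ∧ ∃ X : Matrix (Fin n) (Fin n) ℝ, X.PosSemidef ∧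
      M = s • Q - X * A - Aᵀ * X}
  have hCsmul : ∀ r : ℝ, 0 ≤ r → ∀ M ∈ C, r • M ∈ C := by
    rintro r hr M ⟨s, hs, X, hX, rfl⟩
    exact ⟨r * s, mul_nonneg hr hs, r • X, hX.smul hr, by
      simp [smul_sub, mul_smul]⟩
  by_cases hdisj : Disjoint (coerciveMatrices n) C
  · exfalso
    have hCconv : Convex ℝ C := by
      rintro M hM N hN a b ha hb -
      obtain ⟨s, hs, X, hX, e⟩ := hCsmul a ha M hM
      obtain ⟨s', hs', X', hX', e'⟩ := hCsmul b hb N hN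
      rw [e, e']
      refine ⟨s + s', add_nonneg hs hs', X + X', hX.add hX', ?_⟩
      rw [add_smul, Matrix.add_mul, Matrix.mul_add]; abel
    obtain ⟨f, c, hfU, hfC⟩ := geometric_hahn_banach_open convex_coerciveMatrices
      isOpen_coerciveMatrices hCconv hdisj
    have hc : c ≤ 0 := by
      simpa using hfC 0 ⟨0, le_rfl, 0, PosSemidef.zero, by simp⟩
    have hfC0 : ∀ M ∈ C, 0 ≤ f M := by
      intro M hM
      by_contra! hneg
      have h := hfC _ (hCsmul ((c - 1) / f M) (div_nonneg_of_nonpos (by linarith) hneg.le) M hM)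
      rw [map_smul, smul_eq_mul, div_mul_cancel₀ _ hneg.ne] at h
      linarith
    have hf1 : f 1 < 0 := (hfU 1 ⟨1, one_pos, fun v => by simp⟩).trans_le hc
    have hfpsd : ∀ X : Matrix (Fin n) (Fin n) ℝ, X.PosSemidef → f X ≤ 0 := by
      intro X hX
      refine le_of_forall_pos_le_add fun ε hε => ?_
      have h := hfU (X + (ε / -f 1) • 1) ⟨ε / -f 1, div_pos hε (neg_pos.2 hf1), fun v => by
        have := (posSemidef_iff_real.1 hX).2 v
        rw [add_mulVec, smul_mulVec, one_mulVec, dotProduct_add, dotProduct_smul, smul_eq_mul]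
        linarith⟩
      rw [map_add, map_smul, smul_eq_mul] at h
      have : ε / -f 1 * f 1 = -ε := by
        rw [div_neg, neg_mul, div_mul_cancel₀ _ hf1.ne]
      linarith
    obtain ⟨Z, hZt, hZ⟩ := exists_symm_trace_eq (-(f : Matrix (Fin n) (Fin n) ℝ →ₗ[ℝ] ℝ))
    have hZ : ∀ M, Mᵀ = M → (Z * M).trace = -f M := fun M hM => (hZ M hM).symm
    have hpos : ∀ X : Matrix (Fin n) (Fin n) ℝ, X.PosSemidef → 0 ≤ (Z * X).trace := fun X hX => by
      rw [hZ X (posSemidef_iff_real.1 hX).1]; linarith [hfpsd X hX]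
    have hvv : ∀ v : Fin n → ℝ, (vecMulVec v v).PosSemidef := fun v => by
      simpa using posSemidef_vecMulVec_self_star v
    have hZpsd : Z.PosSemidef := posSemidef_iff_real.2 ⟨hZt, fun v => by
      rw [← trace_mul_vecMulVec]; exact hpos _ (hvv v)⟩
    have hZQ : Z * Q = 0 := by
      refine mul_eq_zero_of_trace_mul_eq_zero hZpsd hQ (le_antisymm ?_ (hpos Q hQ))
      rw [hZ Q hQt, neg_nonpos]
      exact hfC0 Q ⟨1, zero_le_one, 0, PosSemidef.zero, by simp⟩
    have hlyap : ∀ X : Matrix (Fin n) (Fin n) ℝ, X.PosSemidef →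
        0 ≤ (Z * (X * A + Aᵀ * X)).trace := by
      intro X hX
      have hXt := (posSemidef_iff_real.1 hX).1
      rw [hZ _ (by simp [hXt, add_comm]), ← map_neg]
      exact hfC0 _ ⟨0, le_rfl, X, hX, by rw [zero_smul]; abel⟩
    have hG : (A * Z + Z * Aᵀ).PosSemidef := by
      refine posSemidef_iff_real.2 ⟨by simp [hZt, add_comm], fun v => ?_⟩
      have h := hlyap _ (hvv v)
      have e : (Z * (vecMulVec v v * A + Aᵀ * vecMulVec v v)).trace =
          v ⬝ᵥ ((A * Z + Z * Aᵀ) *ᵥ v) := by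
        rw [Matrix.mul_add, trace_add, ← Matrix.mul_assoc, trace_mul_comm, ← Matrix.mul_assoc,
          ← Matrix.mul_assoc, trace_mul_vecMulVec, trace_mul_vecMulVec, add_mulVec,
          dotProduct_add]
      rwa [e] at h
    -- On the kernel of `Z` the semidefinite form of `A * Z + Z * Aᵀ` is zero, so the vector lies in
    -- its kernel too. Dually, the range of `Z` is invariant under `A`.
    have hker : ∀ x, Z *ᵥ x = 0 → Z *ᵥ (Aᵀ *ᵥ x) = 0 := by
      intro x hx
      have h1 : x ⬝ᵥ ((A * Z + Z * Aᵀ) *ᵥ x) = 0 := by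
        rw [add_mulVec, ← mulVec_mulVec, hx, mulVec_zero, zero_add, ← mulVec_mulVec,
          dotProduct_mulVec, ← hZt, vecMul_transpose, hx, zero_dotProduct]
      have h2 : (A * Z + Z * Aᵀ) *ᵥ x = 0 := by
        rw [← hG.dotProduct_mulVec_zero_iff]; simpa using h1
      rwa [add_mulVec, ← mulVec_mulVec, hx, mulVec_zero, zero_add, ← mulVec_mulVec] at h2
    have hpow : ∀ k : ℕ, Z * (Aᵀ ^ k * Q) = 0 := by
      intro k
      refine ext_dotProduct_mulVec fun v w => ?_
      suffices h : Z *ᵥ ((Aᵀ ^ k) *ᵥ (Q *ᵥ w)) = 0 by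
        rw [← mulVec_mulVec, ← mulVec_mulVec, h, zero_mulVec]
      induction k with
      | zero => rw [pow_zero, one_mulVec, mulVec_mulVec, hZQ, zero_mulVec]
      | succ k ih => rw [pow_succ', ← mulVec_mulVec]; exact hker _ ih
    have hKZ : K * Z = 0 := by
      refine ext_dotProduct_mulVec fun v w => ?_
      rw [← mulVec_mulVec, hunobs, zero_mulVec]
      intro k
      have h := congrArg transpose (hpow k)
      rw [transpose_mul, transpose_mul, transpose_pow, transpose_transpose, hQt, hZt,
        transpose_zero] at h
      rw [mulVec_mulVec, mulVec_mulVec, h, zero_mulVec]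
    -- The terms with `K` disappear against `Z`, leaving `-tr Z = f 1 < 0` for a trace already known
    -- to be nonnegative.
    obtain ⟨S, hS, hSl⟩ := exists_lyapunov hK (PosSemidef.one (n := Fin n) (R := ℝ))
    have e : S * A + Aᵀ * S = -1 + S * B * K + Kᵀ * (Bᵀ * S) := by
      rw [← hSl]
      simp only [transpose_sub, transpose_mul, Matrix.mul_sub, Matrix.sub_mul, Matrix.mul_assoc]
      abel
    have h := hlyap S hS
    have hZK : Z * Kᵀ = 0 := by
      have := congrArg transpose hKZ
      rwa [transpose_mul, hZt, transpose_zero] at this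
    rw [e, Matrix.mul_add, Matrix.mul_add, ← Matrix.mul_assoc Z Kᵀ, hZK, Matrix.zero_mul, add_zero,
      trace_add, ← Matrix.mul_assoc Z, trace_mul_comm (Z * (S * B)) K, ← Matrix.mul_assoc K, hKZ,
      Matrix.zero_mul, trace_zero, add_zero, Matrix.mul_neg, trace_neg, hZ 1 transpose_one] at h
    linarith
  · obtain ⟨M, ⟨c, hc, hcM⟩, s, hs, X, hX, rfl⟩ := Set.not_disjoint_iff.1 hdisj
    have hXt := (posSemidef_iff_real.1 hX).1
    -- Adding one more `Q` and dividing by `s + 1` normalizes its coefficient even when `s = 0`. A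
    -- small `ε` then makes `X` definite by openness.
    let N : ℝ → Matrix (Fin n) (Fin n) ℝ := fun ε =>
      Q - ((s + 1)⁻¹ • (X + ε • 1)) * A - Aᵀ * ((s + 1)⁻¹ • (X + ε • 1))
    have hs1 : 0 < s + 1 := by linarith
    have hN : Continuous N := by fun_prop
    have hN0 : N 0 ∈ coerciveMatrices n := by
      refine ⟨(s + 1)⁻¹ * c, mul_pos (inv_pos.2 hs1) hc, fun v => ?_⟩
      have e : N 0 = (s + 1)⁻¹ • (Q + (s • Q - X * A - Aᵀ * X)) := by
        have : Q = (s + 1)⁻¹ • ((s + 1) • Q) := (inv_smul_smul₀ hs1.ne' Q).symm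
        simp only [N, zero_smul, add_zero]
        conv_lhs => rw [this]
        rw [smul_mul_assoc, mul_smul_comm, ← smul_sub, ← smul_sub, add_smul, one_smul]
        congr 1; abel
      rw [e, smul_mulVec, dotProduct_smul, add_mulVec, dotProduct_add, smul_eq_mul, mul_assoc]
      refine mul_le_mul_of_nonneg_left ?_ (inv_pos.2 hs1).le
      linarith [hcM v, (posSemidef_iff_real.1 hQ).2 v]
    have hev : ∀ᶠ ε in 𝓝[>] (0 : ℝ), N ε ∈ coerciveMatrices n :=
      (hN.continuousAt.eventually_mem (isOpen_coerciveMatrices.mem_nhds hN0)).filter_mono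
        nhdsWithin_le_nhds
    obtain ⟨ε, hε, hε0⟩ := (hev.and self_mem_nhdsWithin).exists
    have hPt : (X + ε • (1 : Matrix (Fin n) (Fin n) ℝ)).PosDef :=
      PosDef.posSemidef_add hX (PosDef.one.smul hε0)
    refine ⟨(s + 1)⁻¹ • (X + ε • 1), hPt.smul (inv_pos.2 hs1),
      posDef_of_mem_coerciveMatrices hε ?_⟩
    simp only [transpose_sub, transpose_mul, transpose_smul, transpose_add, transpose_one, hXt,
      hQt, transpose_transpose]
    abel

end LMI

/-! ### The data-based program -/

section Frobenius

attribute [local instance] Matrix.frobeniusNormedAddCommGroup Matrix.frobeniusNormedSpace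

theorem frobNorm_nonneg {ι κ : Type*} [Fintype ι] [Fintype κ] (M : Matrix ι κ ℝ) :
    0 ≤ frobNorm M := norm_nonneg M

theorem frobNorm_eq_zero {ι κ : Type*} [Fintype ι] [Fintype κ] {M : Matrix ι κ ℝ} :
    frobNorm M = 0 ↔ M = 0 := norm_eq_zero

theorem frobNorm_add_le {ι κ : Type*} [Fintype ι] [Fintype κ] (M N : Matrix ι κ ℝ) :
    frobNorm (M + N) ≤ frobNorm M + frobNorm N := norm_add_le M N

theorem frobNorm_smul {ι κ : Type*} [Fintype ι] [Fintype κ] {c : ℝ} (hc : 0 ≤ c)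
    (M : Matrix ι κ ℝ) : frobNorm (c • M) = c * frobNorm M := by
  have := norm_smul c M
  rwa [Real.norm_of_nonneg hc] at this

end Frobenius

/-! ### Minimizers of homogeneous functions on cones -/

section Cone

/-- Minimizing a nonnegative homogeneous function over a cone: the minimizers are the zeros. -/
theorem isSolution_iff_of_cone {E : Type*} [SMul ℝ E] {S : Set E} {f : E → ℝ}
    (hS : ∀ z ∈ S, ∀ c : ℝ, 0 < c → c • z ∈ S) (hf : ∀ z, 0 ≤ f z)
    (hfs : ∀ (c : ℝ) z, 0 < c → f (c • z) = c * f z) (z : E) :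
    IsSolution S f z ↔ z ∈ S ∧ f z = 0 := by
  refine ⟨fun ⟨hz, hmin⟩ => ⟨hz, ?_⟩, fun ⟨hz, h0⟩ => ⟨hz, fun w _ => ?_⟩⟩
  -- Halving the point halves its value, so a minimum cannot be positive.
  · have h := hmin (hS z hz (1 / 2) (by norm_num))
    simp only [mem_ofPred_eq, hfs (1 / 2) z (by norm_num)] at h
    linarith [hf z]
  · simp only [mem_ofPred_eq, h0]
    exact hf w

end Cone

/-! ### The model-based problem -/

section Model

variable {n m : ℕ} {A : Matrix (Fin n) (Fin n) ℝ} {B : Matrix (Fin n) (Fin m) ℝ}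
  {K : Matrix (Fin m) (Fin n) ℝ}

theorem smul_mem_modelFeasible {z : Vars n m} (hz : z ∈ modelFeasible A B K) {c : ℝ}
    (hc : 0 < c) : c • z ∈ modelFeasible A B K := by
  obtain ⟨Q, R, P, P₁⟩ := z
  obtain ⟨hQ, hP, hR, hP₁, he, hd⟩ := hz
  refine ⟨hQ.smul hc.le, hP.smul hc.le, hR.smul hc, hP₁.smul hc, ?_, ?_⟩
  · have := congrArg (c • ·) he
    simpa [smul_add] using this
  · have := hd.smul hc
    simpa [smul_sub] using this

theorem add_mem_modelFeasible {z w : Vars n m} (hz : z ∈ modelFeasible A B K)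
    (hw : w ∈ modelFeasible A B K) : z + w ∈ modelFeasible A B K := by
  obtain ⟨Q, R, P, P₁⟩ := z
  obtain ⟨Q', R', P', P₁'⟩ := w
  obtain ⟨hQ, hP, hR, hP₁, he, hd⟩ := hz
  obtain ⟨hQ', hP', hR', hP₁', he', hd'⟩ := hw
  refine ⟨hQ.add hQ', hP.add hP', hR.add hR', hP₁.add hP₁', ?_, ?_⟩
  · have := congrArg₂ (· + ·) he he'
    simp only [add_zero] at this
    rw [← this]
    simp only [Matrix.mul_add, Matrix.add_mul]
    abel
  · convert hd.add hd' using 1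
    simp only [Matrix.mul_add, Matrix.add_mul]
    abel

theorem convex_modelFeasible : Convex ℝ (modelFeasible A B K) := by
  intro z hz w hw a b ha hb hab
  rcases ha.eq_or_lt with rfl | ha
  · have hb1 : b = 1 := by linarith
    simpa [hb1] using hw
  rcases hb.eq_or_lt with rfl | hb
  · have ha1 : a = 1 := by linarith
    simpa [ha1] using hz
  exact add_mem_modelFeasible (smul_mem_modelFeasible hz ha) (smul_mem_modelFeasible hw hb)

/-- With `R = 1` and `P₁ = 1`, a multiple of the identity dominating `A + Aᵀ` serves as `Q`, and
stability supplies `P`. -/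
theorem modelFeasible_nonempty (hK : Stabilizing A B K) : (modelFeasible A B K).Nonempty := by
  set c := (∑ i, ∑ j, |(A + Aᵀ) i j|) + 1 with hc
  have hc0 : 0 ≤ c := by positivity
  have hQ : (c • (1 : Matrix (Fin n) (Fin n) ℝ)).PosSemidef := PosSemidef.one.smul hc0
  have hW := hQ.add (transpose_mul_mul_posSemidef (PosSemidef.one (n := Fin m) (R := ℝ)) K)
  obtain ⟨P, hP, hPe⟩ := exists_lyapunov hK hW
  refine ⟨(c • 1, 1, P, 1), hQ, hP, PosDef.one, PosDef.one, ?_, ?_⟩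
  · rw [add_assoc, hPe, add_neg_cancel]
  · refine posDef_of_mem_coerciveMatrices ⟨1, one_pos, fun v => ?_⟩ ?_
    · have h := (abs_le.1 (abs_dotProduct_mulVec_le (A + Aᵀ) v)).2
      rw [Matrix.one_mul, Matrix.mul_one, sub_sub, sub_mulVec, dotProduct_sub, smul_mulVec,
        one_mulVec, dotProduct_smul, smul_eq_mul, hc]
      linarith
    · simp; abel

theorem modelObjective_nonneg (z : Vars n m) : 0 ≤ modelObjective B K z := frobNorm_nonneg _

theorem modelObjective_smul (c : ℝ) (z : Vars n m) (hc : 0 < c) :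
    modelObjective B K (c • z) = c * modelObjective B K z := by
  obtain ⟨Q, R, P, P₁⟩ := z
  show frobNorm ((c • R) * K - Bᵀ * (c • P)) = c * frobNorm (R * K - Bᵀ * P)
  rw [← frobNorm_smul hc.le]
  simp [smul_sub]

theorem modelObjective_eq_zero {Q : Matrix (Fin n) (Fin n) ℝ} {R : Matrix (Fin m) (Fin m) ℝ}
    {P P₁ : Matrix (Fin n) (Fin n) ℝ} :
    modelObjective B K (Q, R, P, P₁) = 0 ↔ R * K - Bᵀ * P = 0 := frobNorm_eq_zero

/-- An optimal stabilizing gain makes the optimal value of the model-based problem zero. -/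
theorem exists_modelObjective_eq_zero (hK : Stabilizing A B K) {Q : Matrix (Fin n) (Fin n) ℝ}
    {R : Matrix (Fin m) (Fin m) ℝ} (hQ : Q.PosSemidef) (hR : R.PosDef)
    (hopt : IsLQROptimal A B Q R K) :
    ∃ z ∈ modelFeasible A B K, modelObjective B K z = 0 := by
  obtain ⟨P, hP, hPe⟩ := exists_lyapunov hK
    (hQ.add (transpose_mul_mul_posSemidef hR.posSemidef K))
  obtain ⟨P₁, hP₁, hd⟩ := exists_strict_lmi hK hQ fun z hz => hopt.mulVec_eq_zero hK hQ hR hz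
  refine ⟨(Q, R, P, P₁), ⟨hQ, hP, hR, hP₁, ?_, hd⟩, ?_⟩
  · rw [add_assoc, hPe, add_neg_cancel]
  · rw [modelObjective_eq_zero, hopt.mul_eq hK hQ hR hP hPe, sub_self]

end Model

/-! ### From data matrices to the model -/

section Data

variable {n m N q M : ℕ} {A : Matrix (Fin n) (Fin n) ℝ} {B : Matrix (Fin n) (Fin m) ℝ}
  {K : Matrix (Fin m) (Fin n) ℝ} {D : ProgramData n m N q M}

theorem dataObjective_nonneg (z : Vars n m) : 0 ≤ dataObjective D z := frobNorm_nonneg _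

theorem dataObjective_smul (c : ℝ) (z : Vars n m) (hc : 0 < c) :
    dataObjective D (c • z) = c * dataObjective D z := by
  obtain ⟨Q, R, P, P₁⟩ := z
  show frobNorm (D.Huᵀ * (c • R) * D.U + D.Hxdᵀ * (c • P) * D.Xi - D.HAᵀ * (c • P) * D.Xi) =
    c * frobNorm (D.Huᵀ * R * D.U + D.Hxdᵀ * P * D.Xi - D.HAᵀ * P * D.Xi)
  rw [← frobNorm_smul hc.le]
  simp [smul_sub, smul_add]

theorem dataObjective_add_le (z w : Vars n m) :
    dataObjective D (z + w) ≤ dataObjective D z + dataObjective D w := by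
  obtain ⟨Q, R, P, P₁⟩ := z
  obtain ⟨Q', R', P', P₁'⟩ := w
  show frobNorm (D.Huᵀ * (R + R') * D.U + D.Hxdᵀ * (P + P') * D.Xi - D.HAᵀ * (P + P') * D.Xi) ≤
    frobNorm (D.Huᵀ * R * D.U + D.Hxdᵀ * P * D.Xi - D.HAᵀ * P * D.Xi) +
    frobNorm (D.Huᵀ * R' * D.U + D.Hxdᵀ * P' * D.Xi - D.HAᵀ * P' * D.Xi)
  refine le_of_eq_of_le ?_ (frobNorm_add_le _ _)
  congr 1
  simp only [Matrix.mul_add, Matrix.add_mul]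
  abel

theorem convexOn_dataObjective {S : Set (Vars n m)} (hS : Convex ℝ S) :
    ConvexOn ℝ S (dataObjective D) := by
  refine ⟨hS, fun z _ w _ a b ha hb hab => ?_⟩
  rcases ha.eq_or_lt with rfl | ha
  · have hb1 : b = 1 := by linarith
    simp [hb1]
  rcases hb.eq_or_lt with rfl | hb
  · have ha1 : a = 1 := by linarith
    simp [ha1]
  rw [smul_eq_mul, smul_eq_mul, ← dataObjective_smul a z ha, ← dataObjective_smul b w hb]
  exact dataObjective_add_le _ _

/-- The right inverse `Y` undoes the congruence by `Xi`. The right inverse `X` makes `Hx`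
surjective, so `Hx *ᵥ v` runs through all nonzero vectors. -/
theorem dataFeasible_eq_modelFeasible {Y : Matrix (Fin q × Fin M) (Fin n) ℝ} (hY : D.Xi * Y = 1)
    {X : Matrix (Fin N) (Fin n) ℝ} (hX : D.Hx * X = 1) (hHA : D.HA = A * D.Hx)
    (hXid : D.Xid = (A - B * K) * D.Xi) (hU : D.U = -(K * D.Xi)) :
    dataFeasible D = modelFeasible A B K := by
  ext ⟨Q, R, P, P₁⟩
  have hYt : Yᵀ * D.Xiᵀ = 1 := by rw [← transpose_mul, hY, transpose_one]
  have e1 : D.Xiᵀ * Q * D.Xi + D.Uᵀ * R * D.U + D.Xiᵀ * P * D.Xid + D.Xidᵀ * P * D.Xi =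
      D.Xiᵀ * (Q + Kᵀ * R * K + P * (A - B * K) + (A - B * K)ᵀ * P) * D.Xi := by
    rw [hU, hXid]
    simp only [transpose_neg, transpose_mul, Matrix.mul_add, Matrix.add_mul, Matrix.neg_mul,
      Matrix.mul_neg, neg_neg, Matrix.mul_assoc]
  have h1 : (D.Xiᵀ * Q * D.Xi + D.Uᵀ * R * D.U + D.Xiᵀ * P * D.Xid + D.Xidᵀ * P * D.Xi = 0) ↔
      Q + Kᵀ * R * K + P * (A - B * K) + (A - B * K)ᵀ * P = 0 := by
    rw [e1]
    generalize Q + Kᵀ * R * K + P * (A - B * K) + (A - B * K)ᵀ * P = S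
    refine ⟨fun h => ?_, fun h => by simp [h]⟩
    calc S = (Yᵀ * D.Xiᵀ) * S * (D.Xi * Y) := by rw [hYt, hY, Matrix.one_mul, Matrix.mul_one]
      _ = Yᵀ * (D.Xiᵀ * S * D.Xi) * Y := by simp only [Matrix.mul_assoc]
      _ = 0 := by rw [h, Matrix.mul_zero, Matrix.zero_mul]
  have e2 : ∀ v, v ⬝ᵥ ((D.Hxᵀ * Q * D.Hx - D.Hxᵀ * P₁ * D.HA - D.HAᵀ * P₁ * D.Hx) *ᵥ v) =
      (D.Hx *ᵥ v) ⬝ᵥ ((Q - P₁ * A - Aᵀ * P₁) *ᵥ (D.Hx *ᵥ v)) := by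
    intro v
    have : D.Hxᵀ * Q * D.Hx - D.Hxᵀ * P₁ * D.HA - D.HAᵀ * P₁ * D.Hx =
        D.Hxᵀ * ((Q - P₁ * A - Aᵀ * P₁) * D.Hx) := by
      rw [hHA]
      simp only [transpose_mul, Matrix.mul_sub, Matrix.sub_mul, Matrix.mul_assoc]
    rw [this, ← mulVec_mulVec, dotProduct_mulVec, vecMul_transpose, ← mulVec_mulVec]
  show (Q.PosSemidef ∧ P.PosSemidef ∧ R.PosDef ∧ P₁.PosDef ∧ _ ∧ _) ↔
    (Q.PosSemidef ∧ P.PosSemidef ∧ R.PosDef ∧ P₁.PosDef ∧ _ ∧ _)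
  refine and_congr_right fun hQ => and_congr_right fun _ => and_congr_right fun _ =>
    and_congr_right fun hP₁ => and_congr h1 ?_
  simp_rw [e2]
  rw [posDef_iff_real]
  refine ⟨fun h => ⟨?_, fun w hw => ?_⟩, fun h v hv => h.2 _ hv⟩
  · simp only [transpose_sub, transpose_mul, transpose_transpose, (posSemidef_iff_real.1 hQ).1,
      (posDef_iff_real.1 hP₁).1]
    abel
  · have hXw : D.Hx *ᵥ (X *ᵥ w) = w := by rw [mulVec_mulVec, hX, one_mulVec]
    have := h (X *ᵥ w)
    rw [hXw] at this
    exact this hw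

theorem dataObjective_eq_zero_iff {Y : Matrix (Fin q × Fin M) (Fin n) ℝ} (hY : D.Xi * Y = 1)
    {V : Matrix (Fin N) (Fin m) ℝ} (hV : D.Hu * V = 1) (hHA : D.HA = A * D.Hx)
    (hHxd : D.Hxd = A * D.Hx + B * D.Hu) (hU : D.U = -(K * D.Xi)) (z : Vars n m) :
    dataObjective D z = 0 ↔ modelObjective B K z = 0 := by
  obtain ⟨Q, R, P, P₁⟩ := z
  have hVt : Vᵀ * D.Huᵀ = 1 := by rw [← transpose_mul, hV, transpose_one]
  rw [modelObjective_eq_zero]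
  show frobNorm (D.Huᵀ * R * D.U + D.Hxdᵀ * P * D.Xi - D.HAᵀ * P * D.Xi) = 0 ↔ _
  have e : D.Huᵀ * R * D.U + D.Hxdᵀ * P * D.Xi - D.HAᵀ * P * D.Xi =
      -(D.Huᵀ * (R * K - Bᵀ * P) * D.Xi) := by
    rw [hU, hHxd, hHA]
    simp only [transpose_add, transpose_mul, Matrix.mul_sub, Matrix.sub_mul, Matrix.add_mul,
      Matrix.mul_neg, Matrix.mul_assoc]
    abel
  rw [frobNorm_eq_zero, e, neg_eq_zero]
  generalize R * K - Bᵀ * P = S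
  refine ⟨fun h => ?_, fun h => by simp [h]⟩
  calc S = (Vᵀ * D.Huᵀ) * S * (D.Xi * Y) := by rw [hVt, hY, Matrix.one_mul, Matrix.mul_one]
    _ = Vᵀ * (D.Huᵀ * S * D.Xi) * Y := by simp only [Matrix.mul_assoc]
    _ = 0 := by rw [h, Matrix.mul_zero, Matrix.zero_mul]

end Data

/-! ### Rank of the collected data -/

section Collect

variable {n m N : ℕ} {A : Matrix (Fin n) (Fin n) ℝ} {B : Matrix (Fin n) (Fin m) ℝ} {T : ℝ}
  {u : ℝ → Fin m → ℝ} {x : ℝ → Fin n → ℝ} {μ : ℕ → Fin m → ℝ} {t : ℝ}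

theorem hankelRowDeriv_eq (hT : 0 < T) (hx : IsTrajectory A B u x (N * T))
    (hu : ∀ i < N, ∀ t ∈ Ico 0 T, u (t + i * T) = μ i) (ht : t ∈ Icc 0 T) :
    hankelRowDeriv T N x t = A * hankelRow T N x t + B * hankelRow T N u 0 := by
  ext r i
  have hs : t + i * T ∈ Icc ((i : ℝ) * T) (((i : ℝ) + 1) * T) :=
    ⟨by linarith [ht.1], by linarith [ht.2]⟩
  have hd := hx.hasDerivWithinAt hT hu i i.2 _ hs
  have hlt : ((i : ℕ) : ℝ) * T < ((i : ℝ) + 1) * T := by linarith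
  have h0 := hu i i.2 0 ⟨le_rfl, hT⟩
  simp only [hankelRowDeriv, of_apply]
  rw [hd.derivWithin (uniqueDiffOn_Icc hlt _ hs), ← h0]
  rfl

theorem vecMul_hankelRow {d : ℕ} (f : ℝ → Fin d → ℝ) (v : Fin d → ℝ) (i : Fin N) :
    complexify v ⬝ᵥ complexify (f (t + i * T)) = ((v ᵥ* hankelRow T N f t) i : ℝ) := by
  simp [complexify, vecMul, dotProduct, hankelRow]

/-- Joint independence of the state and input rows is applied to functionals with one of the two
components zero. -/
theorem exists_right_inverse_hankelRow (hAB : Controllable A B) (hA : NonpathologicalPeriod A T)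
    (hT : 0 < T) (hx : IsTrajectory A B u x (N * T))
    (hu : ∀ i < N, ∀ t ∈ Ico 0 T, u (t + i * T) = μ i)
    (hμ : (blockHankel μ N (n + 1)).rank = m * (n + 1)) (ht : t ∈ Icc 0 T) :
    (∃ X : Matrix (Fin N) (Fin n) ℝ, hankelRow T N x t * X = 1) ∧
      ∃ V : Matrix (Fin N) (Fin m) ℝ, hankelRow T N u 0 * V = 1 := by
  have key := fun w η => eq_zero_of_persistently_exciting (w := w) (η := η) hAB hA hT hμ
    (hx.hasDerivWithinAt hT hu) ht
  have hc0 : ∀ {d : ℕ} {v : Fin d → ℝ}, complexify v = 0 → v = 0 := fun h => by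
    ext i; simpa [complexify] using congrFun h i
  refine ⟨exists_mul_eq_one_of_vecMul fun v hv => hc0 (key (complexify v) 0 fun i hi => ?_).1,
    exists_mul_eq_one_of_vecMul fun v hv => hc0 (key 0 (complexify v) fun i hi => ?_).2⟩
  · have := vecMul_hankelRow (t := t) (T := T) x v (⟨i, hi⟩ : Fin N)
    rw [zero_dotProduct, add_zero, this, hv]; simp
  · have := vecMul_hankelRow (t := 0) (T := T) u v (⟨i, hi⟩ : Fin N)
    rw [zero_dotProduct, zero_add, ← hu i hi 0 ⟨le_rfl, hT⟩, this, hv]; simp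

end Collect

end InverseLQR

open InverseLQR
theorem theorem6 {n m N q M : ℕ}
    (A : Matrix (Fin n) (Fin n) ℝ) (B : Matrix (Fin n) (Fin m) ℝ) (K : Matrix (Fin m) (Fin n) ℝ)
    (hAB : Controllable A B)
    -- persistently exciting input-state data
    (T : ℝ) (hT : 0 < T) (u : ℝ → Fin m → ℝ) (x : ℝ → Fin n → ℝ)
    (hu : IsPCPE A T N (n + 1) u) (hx : IsTrajectory A B u x (N * T))
    -- closed-loop trajectories of a stabilizing gain, sampled at the times `τ j`
    (hK : Stabilizing A B K)
    (ξ : Fin M → ℝ → Fin n → ℝ) (ν : Fin M → ℝ → Fin m → ℝ) (ξd : Fin M → ℝ → Fin n → ℝ)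
    (hξ : ∀ i, IsClosedLoopData A B K T (ξ i) (ν i) (ξd i))
    (τ : Fin q → ℝ) (hτ : ∀ j, τ j ∈ Set.Icc 0 T)
    (hrank : (sampleMatrix ξ τ).rank = n)
    -- the fixed time and the resulting data of the program
    (t : ℝ) (ht : t ∈ Set.Icc 0 T)
    (D : ProgramData n m N q M) (hD : D = collect A T N u x t ξ ν ξd τ) :
    -- the program is convex and feasible
    (Convex ℝ (dataFeasible D) ∧ ConvexOn ℝ (dataFeasible D) (dataObjective D) ∧
      (dataFeasible D).Nonempty) ∧
    -- its feasible points are those of the model-based problem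
    dataFeasible D = modelFeasible A B K ∧
    -- its solutions are those of the model-based problem
    (∀ z : Vars n m, IsSolution (dataFeasible D) (dataObjective D) z ↔
      IsSolution (modelFeasible A B K) (modelObjective B K) z) ∧
    -- if `K` is optimal for some cost, the minimum exists and is zero
    ((∃ (Q : Matrix (Fin n) (Fin n) ℝ) (R : Matrix (Fin m) (Fin m) ℝ),
        Q.PosSemidef ∧ R.PosDef ∧ IsLQROptimal A B Q R K) →
      (∃ z : Vars n m, IsSolution (dataFeasible D) (dataObjective D) z) ∧
      ∀ z : Vars n m, IsSolution (dataFeasible D) (dataObjective D) z →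
        dataObjective D z = 0) := by
  obtain ⟨hA, μ, hμ, hrk⟩ := hu
  obtain ⟨⟨X, hX⟩, V, hV⟩ := exists_right_inverse_hankelRow hAB hA hT hx hμ hrk ht
  obtain ⟨Y, hY⟩ : ∃ Y : Matrix (Fin q × Fin M) (Fin n) ℝ, sampleMatrix ξ τ * Y = 1 :=
    exists_mul_eq_one_of_vecMul fun v hv =>
    eq_zero_of_vecMul_eq_zero (hrank.trans (Fintype.card_fin n).symm) hv
  have hXid : sampleMatrix ξd τ = (A - B * K) * sampleMatrix ξ τ := by
    ext r p
    exact congrFun (hξ p.2 _ (hτ p.1)).2.1 r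
  have hU : sampleMatrix ν τ = -(K * sampleMatrix ξ τ) := by
    ext r p
    exact congrFun (hξ p.2 _ (hτ p.1)).2.2 r
  have hHxd := hankelRowDeriv_eq hT hx hμ ht
  have hfeas : dataFeasible D = modelFeasible A B K := by
    subst hD
    exact dataFeasible_eq_modelFeasible hY hX rfl hXid hU
  have hzero : ∀ z, dataObjective D z = 0 ↔ modelObjective B K z = 0 := by
    subst hD
    exact dataObjective_eq_zero_iff hY hV rfl hHxd hU
  -- Only the zero sets of the objectives need to agree, because on this cone minimizers and
  -- feasible zeros are the same.
  have hdata : ∀ z, IsSolution (dataFeasible D) (dataObjective D) z ↔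
      z ∈ modelFeasible A B K ∧ modelObjective B K z = 0 := fun z => by
    rw [hfeas, isSolution_iff_of_cone (fun z hz c hc => smul_mem_modelFeasible hz hc)
      dataObjective_nonneg dataObjective_smul, hzero]
  refine ⟨⟨?_, ?_, ?_⟩, hfeas, fun z => ?_, ?_⟩
  · rw [hfeas]; exact convex_modelFeasible
  · rw [hfeas]; exact convexOn_dataObjective convex_modelFeasible
  · rw [hfeas]; exact modelFeasible_nonempty hK
  · rw [hdata, isSolution_iff_of_cone (fun z hz c hc => smul_mem_modelFeasible hz hc)
      modelObjective_nonneg modelObjective_smul]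
  · rintro ⟨Q, R, hQ, hR, hopt⟩
    obtain ⟨z, hz, hz0⟩ := exists_modelObjective_eq_zero hK hQ hR hopt
    exact ⟨⟨z, (hdata z).2 ⟨hz, hz0⟩⟩, fun z hz => (hzero z).2 ((hdata z).1 hz).2⟩
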